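/- **Theorem 4.5.** All quantities below except $\phi,\psi,a,b,r,g_0,\gamma,c,C,\sigma,B$ and the error law depend on a parameter $\nu\to\infty$. *Wavelets and signal.* Let $a<0<b$, let $\phi,\psi$ be bounded measurable functions supported on $[a,b]$, with $\int\phi=1$, the integer translates of $\phi$ orthonormal, and $\psi$ of order $r\ge1$: $\int u^k\psi(u)\,du=0$ for $0\le k<r$ and $\int u^r\psi(u)\,du\ne0$. Let $g_0$ and $\gamma$ be $r$ times continuously differentiable on $\mathbb R$, with $\gamma$ supported on $[-1,1]$ and $\gamma^{(r)}(0)\ne0$. Let $J=[x,y]$ be an interval contained, for all large $\nu$, in a fixed bounded interval, and let $g=g_0+\sum_k\gamma\{\alpha_k(\cdot-u_k)\}$ (finitely or countably many terms, $\alpha_k>0$), where each $\gamma\{\alpha_k(\cdot-u_k)\}$ is supported in $J$ and no two of the intervals $[u_k-\alpha_k^{-1},u_k+\alpha_k^{-1}]$ overlap. *Parameters.* Let $\xi>0$ be the grid edge length, $\ell\ge1$ an integer, $\rho_1=(\ell\xi)^{-1}$, $\rho_2=\xi^{-1}$, $p>0$, $p_i=2^ip$, $q_2\in\mathbb N$,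 $\pi_2>0$, and $\psi_{ij}(s)=p_i^{1/2}\psi(p_is-j)$. Let $\tau_0$ be the least integer multiple of $\ell\xi$ that is at least $(b-a)/p$. Assume $\rho_1\to\infty$, $p\asymp\rho_1^{1/(2r+1)}$, $q_2\to\infty$, $2^{q_2}=O(p^{-1}\rho_2^{1-c})$ with $c\in(0,1)$, $\rho_1=o(\pi_2)$, and $\pi_2\le p_{q_2}$ for all large $\nu$. Let $\sigma>0$, $C>2^{1/2}$, $B>C^2/(1-c)$, and $\delta_2=C\sigma(\rho_2^{-1}\log\rho_2)^{1/2}$. *Data.* At each grid time $k\xi$, $k\in\mathbb Z$, the sampling rate is either $\rho_1$ or $\rho_2$; the signal is sampled at $k\xi$ if the rate is $\rho_2$ or if $\ell$ divides $k$, and the datum is then $Y_k=g(k\xi)+\varepsilon_k$. There is a filtration $(\mathcal F_k)$ such that the rate at time $k\xi$ is $\mathcal F_{k-1}$-measurable, $\varepsilon_k$ is $\mathcal F_k$-measurable, and the conditional law of $\varepsilon_k$ given $\mathcal F_{k-1}$ is a fixed law (not depending on $k$ or $\nu$) with zero mean, variance $\sigma^2$ and finite absolute moment of order $6+B$. Let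 $Z_k$ be the datum recorded at the last sampling time not exceeding $k\xi$, put $Z^t(s)=Z_k$ for $k\xi\le s<\min\{(k+1)\xi,t\}$ and $Z^t(s)=0$ for $s\ge t$, and $\hat b_{ij}^t=\int Z^t\psi_{ij}$. *Downward rule (R.2).* Almost surely, the rate is reduced from $\rho_2$ to $\rho_1$ at a grid time $t=k\xi$ if and only if it has been $\rho_2$ for at least the last $\tau_0$ time units and $|\hat b_{ij}^t|\le\delta_2$ for each pair $(i,j)$ ($i\ge0$, $j\in\mathbb Z$) for which $\pi_2\le p_i\le p_{q_2}$ and $\psi_{ij}(s)\ne0$ for some $s\in[t-\tau_0,t]$. (No particular rule for increasing the rate is assumed.) *Condition (4.11).* There is a subset $\mathcal A$ of the set of frequencies $\alpha_k$ such that, for each interval $\mathcal K\subseteq J$ of length $\tau_0$, some $\gamma\{\alpha_k(\cdot-u_k)\}$ with $\alpha_k\in\mathcal A$ is supported within $\mathcal K$; moreover $\pi_2=o(\inf_{\alpha\in\mathcal A}\alpha)$ and $\sup_{\alpha\in\mathcal A}\alpha=o(p_{q_2})$. *Conclusion.* Suppose that the event that sampling at rate $\rho_2$ starts at the start of $J$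 (the rate is $\rho_2$ at the first grid time $\ge x$ and was $\rho_1$ at the grid time before) has positive probability. Then, conditionally on this event, the probability that the sampling rate is $\rho_2$ at all grid times in $J$ converges to $1$ as $\nu\to\infty$. In particular, if this event has probability $1$, the rate stays at $\rho_2$ throughout $J$ with probability converging to $1$. -/

import Mathlib

open MeasureTheory ProbabilityTheory Filter Topology Asymptotics

/-- The two sampling rates: `low` means that the signal is sampled at the integer multiples of
`ℓ ξ` (rate `ρ₁`), `high` that it is sampled at all integer multiples of `ξ` (rate `ρ₂`). -/
inductive SamplingRate where
  | low : SamplingRate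
  | high : SamplingRate

/-- Deterministic tuning parameters of the dual-rate algorithm that enter the downward rule:
grid edge length `ξ`, ratio `ℓ` of the two rates, primary resolution level `p`, top resolution
index `q₂` at the high rate, and the lower resolution bound `π₂`. -/
structure Design where
  ξ : ℝ
  ξ_pos : 0 < ξ
  ℓ : ℕ
  ℓ_pos : 0 < ℓ
  p : ℝ
  p_pos : 0 < p
  q₂ : ℕ
  π₂ : ℝ
  π₂_pos : 0 < π₂

noncomputable section

namespace Design

/-- The low sampling rate. -/
def ρ₁ (D : Design) : ℝ := (D.ℓ * D.ξ)⁻¹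

/-- The high sampling rate. -/
def ρ₂ (D : Design) : ℝ := D.ξ⁻¹

/-- Resolution levels `pᵢ = 2 ^ i * p`. -/
def level (D : Design) (i : ℕ) : ℝ := 2 ^ i * D.p

/-- The number of grid steps contained in a time interval of length `τ₀`. -/
def delaySteps (D : Design) (a b : ℝ) : ℕ := D.ℓ * ⌈(b - a) / D.p / (D.ℓ * D.ξ)⌉₊

/-- `τ₀`: the least integer multiple of `ℓ ξ` that is not less than `(b - a) / p`. -/
def delay (D : Design) (a b : ℝ) : ℝ := D.delaySteps a b * D.ξ

/-- The threshold `δ₂ = C σ (ρ₂⁻¹ log ρ₂) ^ (1/2)` in force at the high rate. -/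
def threshold (D : Design) (C σ : ℝ) : ℝ := C * σ * √(D.ρ₂⁻¹ * Real.log D.ρ₂)

/-- `ψᵢⱼ(s) = pᵢ ^ (1/2) ψ(pᵢ s - j)`. -/
def wavelet (D : Design) (ψ : ℝ → ℝ) (i : ℕ) (j : ℤ) (s : ℝ) : ℝ :=
  √(D.level i) * ψ (D.level i * s - j)

/-! In what follows `R k` is the sampling rate in force at grid time `k ξ`, and `y k` is the
value that is recorded at grid time `k ξ` if the signal is sampled there. -/

/-- A datum is recorded at grid time `k ξ`. -/
def Sampled (D : Design) (R : ℤ → SamplingRate) (k : ℤ) : Prop :=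
  R k = SamplingRate.high ∨ (D.ℓ : ℤ) ∣ k

/-- Index of the last sampling time that does not exceed `k ξ`. (It exists, because every
multiple of `ℓ` is sampled.) -/
def lastSample (D : Design) (R : ℤ → SamplingRate) (k : ℤ) : ℤ :=
  sSup {m : ℤ | m ≤ k ∧ D.Sampled R m}

/-- The imputed step function `Zᵗ`, based only on data sampled before time `t`. -/
def imputed (D : Design) (R : ℤ → SamplingRate) (y : ℤ → ℝ) (t s : ℝ) : ℝ :=
  if s < t then y (D.lastSample R ⌊s / D.ξ⌋) else 0

/-- The empirical wavelet coefficient `∫ Zᵗ ψᵢⱼ` available at time `t`. -/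
def coeff (D : Design) (ψ : ℝ → ℝ) (R : ℤ → SamplingRate) (y : ℤ → ℝ) (t : ℝ)
    (i : ℕ) (j : ℤ) : ℝ :=
  ∫ s, D.imputed R y t s * D.wavelet ψ i j s

/-- The condition that is tested at the current time `t` in order to reduce the rate: no
coefficient at a resolution level between `π₂` and `p_{q₂}`, whose wavelet does not vanish
identically on `[t - τ₀, t]`, exceeds the threshold. -/
def DownCondition (D : Design) (a b : ℝ) (ψ : ℝ → ℝ) (δ : ℝ) (R : ℤ → SamplingRate)
    (y : ℤ → ℝ) (t : ℝ) : Prop :=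
  ∀ (i : ℕ) (j : ℤ), D.π₂ ≤ D.level i → D.level i ≤ D.level D.q₂ →
    (∃ s ∈ Set.Icc (t - D.delay a b) t, D.wavelet ψ i j s ≠ 0) →
    |D.coeff ψ R y t i j| ≤ δ

/-- The downward rate-switching rule: sampling at the high rate is given up at grid time `k ξ`
if and only if the high rate has been in force for at least `τ₀` time units and the condition
above holds at the current time `k ξ`. Upward switches are left unrestricted. -/
def FollowsDownRule (D : Design) (a b : ℝ) (ψ : ℝ → ℝ) (δ : ℝ) (R : ℤ → SamplingRate)
    (y : ℤ → ℝ) : Prop :=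
  ∀ k : ℤ, R (k - 1) = SamplingRate.high →
    (R k = SamplingRate.low ↔
      (∀ m : ℤ, k - D.delaySteps a b ≤ m → m < k → R m = SamplingRate.high) ∧
        D.DownCondition a b ψ δ R y (k * D.ξ))

/-- Sampling at the high rate starts at the start of an interval with left endpoint `x`: at the
first grid time of the interval the rate is `ρ₂`, and immediately before that it was `ρ₁`. -/
def StartsHigh (D : Design) (x : ℝ) (R : ℤ → SamplingRate) : Prop :=
  R ⌈x / D.ξ⌉ = SamplingRate.high ∧ R (⌈x / D.ξ⌉ - 1) = SamplingRate.low

/-- The sampling rate is `ρ₂` at all grid times in `J`. -/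
def StaysHigh (D : Design) (J : Set ℝ) (R : ℤ → SamplingRate) : Prop :=
  ∀ k : ℤ, (k : ℝ) * D.ξ ∈ J → R k = SamplingRate.high

end Design

/-- Conditions on the father function `φ` and the mother function `ψ`: both are bounded and
supported on `[a, b]`, `∫ φ = 1`, the integer translates of `φ` are orthonormal, and `ψ` is of
order `r ≥ 1`, that is, `r` is the least integer with `∫ u ^ r ψ(u) du ≠ 0`. -/
structure IsWaveletPair (φ ψ : ℝ → ℝ) (a b : ℝ) (r : ℕ) : Prop where
  a_neg : a < 0
  b_pos : 0 < b
  measurable_φ : Measurable φ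
  measurable_ψ : Measurable ψ
  bounded_φ : ∃ M, ∀ u, |φ u| ≤ M
  bounded_ψ : ∃ M, ∀ u, |ψ u| ≤ M
  support_φ : Function.support φ ⊆ Set.Icc a b
  support_ψ : Function.support ψ ⊆ Set.Icc a b
  integral_φ : ∫ u, φ u = 1
  orthonormal_φ : ∀ j : ℤ, ∫ u, φ u * φ (u - j) = if j = 0 then 1 else 0
  one_le_r : 1 ≤ r
  moment_eq_zero : ∀ k < r, ∫ u, u ^ k * ψ u = 0
  moment_ne_zero : ∫ u, u ^ r * ψ u ≠ 0

/-- `law` is a probability distribution with zero mean, variance `σ ^ 2` and a finite absolute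
moment of order `6 + B`. -/
structure IsErrorLaw (law : Measure ℝ) (σ B : ℝ) : Prop where
  isProbability : IsProbabilityMeasure law
  moment : Integrable (fun x : ℝ => |x| ^ (6 + B)) law
  mean : ∫ x, x ∂law = 0
  variance : ∫ x, x ^ 2 ∂law = σ ^ 2

/-- The errors attached to the grid points: with `F k` the information available after grid time
`k`, the conditional distribution of the error `ε k` given the past `F (k - 1)` is `law`, whatever
`k` is (so `ε k` is independent of the past and has distribution `law`). -/
structure IsErrorProcess {Ω : Type*} [mΩ : MeasurableSpace Ω] (P : Measure Ω)
    (F : Filtration ℤ mΩ) (law : Measure ℝ) (ε : ℤ → Ω → ℝ) : Prop where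
  adapted : ∀ k, Measurable[F k] (ε k)
  indep_past : ∀ k, Indep (MeasurableSpace.comap (ε k) inferInstance) (F (k - 1)) P
  has_law : ∀ k, P.map (ε k) = law

/-- The fluctuation `γ{α (· - u)}` of frequency `α` at location `u`. -/
def fluctuation (γ : ℝ → ℝ) (α u s : ℝ) : ℝ := γ (α * (s - u))

/-- The signal `g₀ + ∑ₖ γ{αₖ (· - uₖ)}`, the sum extending over the indices `k ∈ K`. -/
def signal (g₀ γ : ℝ → ℝ) (K : Set ℕ) (α u : ℕ → ℝ) (s : ℝ) : ℝ :=
  g₀ s + ∑' k : K, fluctuation γ (α k) (u k) s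

/-- The fluctuations with indices in `K` have positive frequencies, are supported in the interval
`J`, and no two of the intervals `[uₖ - αₖ⁻¹, uₖ + αₖ⁻¹]` overlap (they may share an endpoint). -/
structure IsCluster (γ : ℝ → ℝ) (J : Set ℝ) (K : Set ℕ) (α u : ℕ → ℝ) : Prop where
  freq_pos : ∀ k ∈ K, 0 < α k
  support_subset : ∀ k ∈ K, Function.support (fluctuation γ (α k) (u k)) ⊆ J
  no_overlap : ∀ k ∈ K, ∀ m ∈ K, k ≠ m →
    Disjoint (Set.Ioo (u k - (α k)⁻¹) (u k + (α k)⁻¹)) (Set.Ioo (u m - (α m)⁻¹) (u m + (α m)⁻¹))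

end

/-! If the rate drops somewhere in `J`, look at the first drop, at time `k ξ`. The rate was low just
before the start of `J`, so the window of length `τ₀` required by the rule lies inside `J`, and by
(4.11) it contains a fluctuation with some frequency `f ∈ A`. The argument shows that the errors
must then behave very improbably.

Signal. Near its centre `u` the fluctuation has nonzero `r`-th derivative, so a wavelet at a level
`pᵢ` comparable to `f` has a coefficient of order at least `pᵢ ^ (-1/2)` (`exists_le_abs_integral`).
The threshold is of smaller order, because `p_{q₂} ξ log ρ₂ → 0`. By taking `pᵢ / f` a large
constant one fits not one but `N` translates of `ψ`, using pairwise disjoint sets of grid cells,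
into this core. Since the rule accepts all of them, `N` weighted sums of errors must each exceed a
fixed multiple of `pᵢ ^ (-1/2)` (`le_abs_noise`).

Noise. Each such sum has variance `O(ξ)`, so Chebyshev bounds its exceedance probability by
`O(p_{q₂} ξ) = O(ρ₂ ^ (-c))`. The blocks are disjoint and each error is independent of the past, so
the conditional bounds multiply to `O(ρ₂ ^ (-cN))` (`measureReal_inter_iInter_le`).

Counting. The wavelets are deterministic once the fluctuation is chosen, and non-overlap leaves only
`O(p_{q₂}) = O(ρ₂)` candidates (`exists_finset_card_le`). The union bound is `O(ρ₂ ^ (1 - cN))`,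
which vanishes for a fixed `N > 1 / c`. The start event is known before the first block, so its
probability is a factor of the whole bound and cancels on conditioning. -/

/-! ### Wavelet coefficients of a smooth function. -/

/-- Taylor's formula with Lagrange remainder on either side of the base point. -/
theorem taylor_add_eq {γ : ℝ → ℝ} {n : ℕ} (hγ : ContDiff ℝ (n + 1 : ℕ) γ) (ζ h : ℝ) :
    ∃ z ∈ Set.uIcc ζ (ζ + h), γ (ζ + h) =
      ∑ k ∈ Finset.range (n + 1), iteratedDeriv k γ ζ / k.factorial * h ^ k +
        iteratedDeriv (n + 1) γ z / (n + 1).factorial * h ^ (n + 1) := by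
  rcases eq_or_ne h 0 with rfl | hh
  · refine ⟨ζ, by simp, ?_⟩
    simp [Finset.sum_range_succ']
  have hne : ζ ≠ ζ + h := by simpa using hh
  obtain ⟨z, hz, hz'⟩ := taylor_mean_remainder_lagrange_iteratedDeriv (n := n) hne
    (by exact_mod_cast hγ.contDiffOn)
  refine ⟨z, ?_, ?_⟩
  · exact Set.uIoo_subset_uIcc_self hz
  · rw [sub_eq_iff_eq_add] at hz'
    rw [hz', taylor_within_apply, add_comm]
    congr 1
    · refine Finset.sum_congr rfl fun k hk => ?_
      rw [iteratedDerivWithin_eq_iteratedDeriv (uniqueDiffOn_uIcc hne) _ Set.left_mem_uIcc]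
      · simp; ring
      · refine (hγ.of_le ?_).contDiffAt
        exact_mod_cast (Finset.mem_range.1 hk).le
    · simp; ring

namespace IsWaveletPair

variable {φ ψ : ℝ → ℝ} {a b : ℝ} {r : ℕ}

theorem integrable_ψ (hW : IsWaveletPair φ ψ a b r) : Integrable ψ := by
  obtain ⟨M, hM⟩ := hW.bounded_ψ
  rw [← integrableOn_iff_integrable_of_support_subset hW.support_ψ]
  exact Measure.integrableOn_of_bounded (M := M) (by simp)
    hW.measurable_ψ.aestronglyMeasurable (Eventually.of_forall fun v => by simpa using hM v)

theorem integrable_mul (hW : IsWaveletPair φ ψ a b r) {G : ℝ → ℝ} (hG : Continuous G) :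
    Integrable fun v => G v * ψ v := by
  rw [← integrableOn_iff_integrable_of_support_subset
    ((Function.support_mul_subset_right G ψ).trans hW.support_ψ)]
  exact hW.integrable_ψ.integrableOn.continuousOn_mul hG.continuousOn isCompact_Icc

theorem integral_ψ (hW : IsWaveletPair φ ψ a b r) : ∫ v, ψ v = 0 := by
  simpa using hW.moment_eq_zero 0 hW.one_le_r

/-- Near a point where the derivative of order `r` does not vanish, the wavelet coefficients of
`γ` at resolution `lam` are at least of order `lam ^ (-r)`. -/
theorem exists_le_abs_integral (hW : IsWaveletPair φ ψ a b r) {γ : ℝ → ℝ}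
    (hγ : ContDiff ℝ r γ) (h0 : iteratedDeriv r γ 0 ≠ 0) :
    ∃ η > 0, η < 1 ∧ (∀ z, |z| ≤ η → iteratedDeriv r γ z ≠ 0) ∧ ∃ κ > 0, ∀ lam > 0, ∀ ζ,
      (∀ v ∈ Set.Icc a b, |ζ + v / lam| ≤ η) →
        κ / lam ^ r ≤ |∫ v, γ (ζ + v / lam) * ψ v| := by
  obtain ⟨n, rfl⟩ := Nat.exists_eq_succ_of_ne_zero (Nat.one_le_iff_ne_zero.1 hW.one_le_r)
  set c₁ := iteratedDeriv (n + 1) γ 0 with hc₁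
  set m := ∫ v, v ^ (n + 1) * ψ v with hm
  set A := ∫ v, |v ^ (n + 1) * ψ v| with hA
  have hm0 : m ≠ 0 := hW.moment_ne_zero
  have hA0 : 0 ≤ A := integral_nonneg fun _ => abs_nonneg _
  have hcm : 0 < |c₁ * m| := abs_pos.2 (mul_ne_zero h0 hm0)
  -- The first bound keeps the Taylor remainder below half of the main term; the second keeps the
  -- derivative away from zero.
  set e := min (|c₁ * m| / (2 * (A + 1))) (|c₁| / 2) with he
  have he0 : 0 < e := lt_min (by positivity) (by have := abs_pos.2 h0; positivity)
  have hcont : Continuous (iteratedDeriv (n + 1) γ) := hγ.continuous_iteratedDeriv _ le_rfl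
  obtain ⟨η, hη, hη'⟩ := Metric.continuous_iff.1 hcont 0 e he0
  set η₁ := min (η / 2) (1 / 2) with hη₁
  have hη₁0 : 0 < η₁ := lt_min (by positivity) (by norm_num)
  have hclose : ∀ z, |z| ≤ η₁ → |iteratedDeriv (n + 1) γ z - c₁| < e := fun z hz => by
    have := hη' z (by
      rw [Real.dist_eq, sub_zero]
      have := min_le_left (η / 2) (1 / 2 : ℝ); linarith)
    rwa [Real.dist_eq] at this
  refine ⟨η₁, hη₁0, lt_of_le_of_lt (min_le_right _ _) (by norm_num), fun z hz hz0 => ?_,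
    |c₁ * m| / (2 * (n + 1).factorial), by positivity, fun lam hlam ζ hζ => ?_⟩
  · have := hclose z hz
    rw [hz0, zero_sub, abs_neg] at this
    have := min_le_right (|c₁ * m| / (2 * (A + 1))) (|c₁| / 2)
    have := abs_pos.2 h0
    linarith
  · set T : ℝ → ℝ := fun v => ∑ k ∈ Finset.range (n + 1),
      iteratedDeriv k γ ζ / k.factorial * (v / lam) ^ k with hT
    -- The vanishing moments remove every Taylor term of degree below `r = n + 1`.
    have hTint : ∫ v, T v * ψ v = 0 := by
      simp only [hT, Finset.sum_mul]
      rw [integral_finsetSum _ fun k _ => hW.integrable_mul (by fun_prop)]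
      refine Finset.sum_eq_zero fun k hk => ?_
      have : ∀ v, iteratedDeriv k γ ζ / k.factorial * (v / lam) ^ k * ψ v =
          iteratedDeriv k γ ζ / k.factorial / lam ^ k * (v ^ k * ψ v) := fun v => by
        rw [div_pow]; ring
      simp only [this]
      rw [integral_const_mul, hW.moment_eq_zero k (Finset.mem_range.1 hk), mul_zero]
    have hQint : ∫ v, c₁ / (n + 1).factorial * (v / lam) ^ (n + 1) * ψ v =
        c₁ * m / (n + 1).factorial / lam ^ (n + 1) := by
      have : ∀ v, c₁ / (n + 1).factorial * (v / lam) ^ (n + 1) * ψ v =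
          c₁ / (n + 1).factorial / lam ^ (n + 1) * (v ^ (n + 1) * ψ v) := fun v => by
        rw [div_pow]; ring
      simp only [this]
      rw [integral_const_mul]; ring
    have hγc : Continuous γ := hγ.continuous
    have hdiff : (∫ v, γ (ζ + v / lam) * ψ v) - c₁ * m / (n + 1).factorial / lam ^ (n + 1) =
        ∫ v, (γ (ζ + v / lam) * ψ v - T v * ψ v
          - c₁ / (n + 1).factorial * (v / lam) ^ (n + 1) * ψ v) := by
      rw [integral_sub, integral_sub, hTint, hQint, sub_zero]
      · exact hW.integrable_mul (by fun_prop)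
      · exact hW.integrable_mul (by fun_prop)
      · exact (hW.integrable_mul (by fun_prop)).sub (hW.integrable_mul (by fun_prop))
      · exact hW.integrable_mul (by fun_prop)
    have hbound : |(∫ v, γ (ζ + v / lam) * ψ v) - c₁ * m / (n + 1).factorial / lam ^ (n + 1)|
        ≤ e / (n + 1).factorial / lam ^ (n + 1) * A := by
      rw [hdiff, hA, ← integral_const_mul, ← Real.norm_eq_abs]
      refine norm_integral_le_of_norm_le
        (((hW.integrable_mul (by fun_prop)).abs).const_mul _) (Eventually.of_forall fun v => ?_)
      by_cases hv : v ∈ Set.Icc a b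
      · obtain ⟨z, hz, hz'⟩ := taylor_add_eq hγ ζ (v / lam)
        have hz1 : |iteratedDeriv (n + 1) γ z - c₁| ≤ e := by
          refine (hclose z ?_).le
          -- Since `a < 0 < b`, the choice `v = 0` is allowed and shows that the base point `ζ` is
          -- itself in the core; so is the intermediate point `z`.
          have h1 := hζ 0 ⟨hW.a_neg.le, hW.b_pos.le⟩
          rw [zero_div, add_zero] at h1
          exact abs_le.2 (Set.uIcc_subset_Icc (abs_le.1 h1) (abs_le.1 (hζ v hv)) hz)
        have : γ (ζ + v / lam) * ψ v - T v * ψ v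
            - c₁ / (n + 1).factorial * (v / lam) ^ (n + 1) * ψ v =
            (iteratedDeriv (n + 1) γ z - c₁) * (((n + 1).factorial : ℝ)⁻¹ / lam ^ (n + 1) *
              (v ^ (n + 1) * ψ v)) := by
          rw [hz', hT, div_pow]; ring
        rw [this, Real.norm_eq_abs, abs_mul, abs_mul,
          abs_of_nonneg (by positivity : 0 ≤ ((n + 1).factorial : ℝ)⁻¹ / lam ^ (n + 1))]
        calc _ ≤ e * (((n + 1).factorial : ℝ)⁻¹ / lam ^ (n + 1) * |v ^ (n + 1) * ψ v|) := by
              gcongr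
          _ = _ := by ring
      · have : ψ v = 0 := by
          by_contra h; exact hv (hW.support_ψ h)
        simp [this]
    have hmain : |c₁ * m / (n + 1).factorial / lam ^ (n + 1)| =
        |c₁ * m| / (n + 1).factorial / lam ^ (n + 1) := by
      rw [abs_div, abs_div, abs_of_nonneg (by positivity : (0 : ℝ) ≤ (n + 1).factorial),
        abs_of_nonneg (by positivity : (0 : ℝ) ≤ lam ^ (n + 1))]
    have heA : e * A ≤ |c₁ * m| / 2 := by
      calc e * A ≤ |c₁ * m| / (2 * (A + 1)) * (A + 1) :=
            mul_le_mul (min_le_left _ _) (by linarith) hA0 (by positivity)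
        _ = _ := by field_simp
    have h3 := abs_sub_abs_le_abs_sub (c₁ * m / (n + 1).factorial / lam ^ (n + 1))
      (∫ v, γ (ζ + v / lam) * ψ v)
    rw [abs_sub_comm] at h3
    have h4 : e / (n + 1).factorial / lam ^ (n + 1) * A ≤
        |c₁ * m| / 2 / (n + 1).factorial / lam ^ (n + 1) := by
      calc _ = e * A / (n + 1).factorial / lam ^ (n + 1) := by ring
        _ ≤ _ := by gcongr
    have h5 : |c₁ * m| / (2 * (n + 1).factorial) / lam ^ (n + 1) =
      |c₁ * m| / (n + 1).factorial / lam ^ (n + 1) -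
        |c₁ * m| / 2 / (n + 1).factorial / lam ^ (n + 1) := by ring
    rw [Nat.succ_eq_add_one, h5]
    linarith

end IsWaveletPair

/-! ### Empirical coefficients as weighted sums over grid cells. -/

namespace Design

/-- The integral of `ψᵢⱼ` over the grid cell `[m ξ, (m + 1) ξ)`. -/
noncomputable def weight (D : Design) (ψ : ℝ → ℝ) (i : ℕ) (j m : ℤ) : ℝ :=
  ∫ s in Set.Ico (m * D.ξ) ((m + 1) * D.ξ), D.wavelet ψ i j s

/-- The index of the grid cell that contains `(e + j) / pᵢ`. -/
noncomputable def cellAt (D : Design) (i : ℕ) (j : ℤ) (e : ℝ) : ℤ :=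
  ⌊(e + j) / D.level i / D.ξ⌋

/-- The grid cells that meet the support of `ψᵢⱼ`. -/
noncomputable def cells (D : Design) (a b : ℝ) (i : ℕ) (j : ℤ) : Finset ℤ :=
  Finset.Icc (D.cellAt i j a) (D.cellAt i j b)

variable (D : Design) {φ ψ : ℝ → ℝ} {a b : ℝ} {r : ℕ} (i : ℕ) (j : ℤ)

theorem level_pos : 0 < D.level i := by
  have := D.p_pos
  unfold level; positivity

theorem lastSample_of_high {R : ℤ → SamplingRate} {k : ℤ} (h : R k = SamplingRate.high) :
    D.lastSample R k = k :=
  IsGreatest.csSup_eq ⟨⟨le_rfl, Or.inl h⟩, fun _ hm => hm.1⟩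

variable {D i j}

theorem mem_Icc_of_wavelet_ne_zero (hW : IsWaveletPair φ ψ a b r) {s : ℝ}
    (hs : D.wavelet ψ i j s ≠ 0) :
    s ∈ Set.Icc ((a + j) / D.level i) ((b + j) / D.level i) := by
  have h := hW.support_ψ (right_ne_zero_of_mul hs)
  have hp := D.level_pos i
  rw [Set.mem_Icc, div_le_iff₀ hp, le_div_iff₀ hp]
  constructor <;> linarith [h.1, h.2]

theorem floor_mem_cells {s : ℝ}
    (hs : s ∈ Set.Icc ((a + j) / D.level i) ((b + j) / D.level i)) :
    ⌊s / D.ξ⌋ ∈ D.cells a b i j := by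
  have hξ := D.ξ_pos
  rw [cells, Finset.mem_Icc]
  exact ⟨Int.floor_le_floor (by gcongr; exact hs.1), Int.floor_le_floor (by gcongr; exact hs.2)⟩

theorem floor_div_eq_iff {s : ℝ} {m : ℤ} :
    ⌊s / D.ξ⌋ = m ↔ s ∈ Set.Ico (m * D.ξ) ((m + 1) * D.ξ) := by
  rw [Int.floor_eq_iff, le_div_iff₀ D.ξ_pos, div_lt_iff₀ D.ξ_pos, Set.mem_Ico]

theorem integrable_wavelet (hW : IsWaveletPair φ ψ a b r) : Integrable (D.wavelet ψ i j) := by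
  have h := (hW.integrable_ψ.comp_sub_right (j : ℝ)).comp_mul_left' (D.level_pos i).ne'
  exact h.const_mul _

theorem integrable_mul_wavelet (hW : IsWaveletPair φ ψ a b r) {G : ℝ → ℝ} (hG : Continuous G) :
    Integrable fun s => G s * D.wavelet ψ i j s := by
  have hs : Function.support (D.wavelet ψ i j) ⊆
      Set.Icc ((a + j) / D.level i) ((b + j) / D.level i) :=
    fun s hs => mem_Icc_of_wavelet_ne_zero hW hs
  rw [← integrableOn_iff_integrable_of_support_subset
    ((Function.support_mul_subset_right G _).trans hs)]
  exact (integrable_wavelet hW).integrableOn.continuousOn_mul hG.continuousOn isCompact_Icc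

theorem integral_mul_wavelet (G : ℝ → ℝ) :
    ∫ s, G s * D.wavelet ψ i j s =
      (√(D.level i))⁻¹ * ∫ v, G ((v + j) / D.level i) * ψ v := by
  have hp := D.level_pos i
  have h1 := Measure.integral_comp_mul_left
    (fun v => G (v / D.level i) * (√(D.level i) * ψ (v - j))) (D.level i)
  have h2 := integral_sub_right_eq_self (μ := volume)
    (fun v => G ((v + j) / D.level i) * (√(D.level i) * ψ v)) (j : ℝ)
  simp only [sub_add_cancel] at h2
  have h3 : ∀ s, G (D.level i * s / D.level i) * (√(D.level i) * ψ (D.level i * s - j)) =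
      G s * D.wavelet ψ i j s := fun s => by
    rw [mul_div_cancel_left₀ _ hp.ne', wavelet]
  simp only [h3] at h1
  rw [h1, h2, smul_eq_mul, abs_of_pos (inv_pos.2 hp)]
  have h4 : ∀ v, G ((v + j) / D.level i) * (√(D.level i) * ψ v) =
      √(D.level i) * (G ((v + j) / D.level i) * ψ v) := fun v => by ring
  simp only [h4]
  rw [integral_const_mul, ← mul_assoc]
  congr 1
  have : √(D.level i) ≠ 0 := (Real.sqrt_pos.2 hp).ne'
  rw [inv_mul_eq_iff_eq_mul₀ hp.ne']
  field_simp
  exact Real.sq_sqrt hp.le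

theorem integral_abs_wavelet :
    ∫ s, |D.wavelet ψ i j s| = (√(D.level i))⁻¹ * ∫ v, |ψ v| := by
  have := integral_mul_wavelet (D := D) (ψ := fun v => |ψ v|) (i := i) (j := j) fun _ => 1
  simp only [one_mul] at this
  rw [← this]
  congr 1; ext s
  rw [wavelet, wavelet, abs_mul, abs_of_nonneg (Real.sqrt_nonneg _)]

theorem mul_wavelet_eq_sum (hW : IsWaveletPair φ ψ a b r) {z : ℝ → ℝ} {y : ℤ → ℝ}
    (hz : ∀ s, D.wavelet ψ i j s ≠ 0 → z s = y ⌊s / D.ξ⌋) (s : ℝ) :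
    z s * D.wavelet ψ i j s = ∑ m ∈ D.cells a b i j,
      y m * (Set.Ico (m * D.ξ) ((m + 1) * D.ξ)).indicator (D.wavelet ψ i j) s := by
  by_cases hs : D.wavelet ψ i j s = 0
  · rw [hs, mul_zero, eq_comm]
    refine Finset.sum_eq_zero fun m _ => ?_
    rw [Set.indicator_apply, hs]; simp
  · rw [hz s hs, Finset.sum_eq_single ⌊s / D.ξ⌋]
    · rw [Set.indicator_of_mem (floor_div_eq_iff.1 rfl)]
    · intro m _ hm
      rw [Set.indicator_of_notMem, mul_zero]
      exact fun h => hm (floor_div_eq_iff.2 h).symm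
    · exact fun h => absurd (floor_mem_cells (mem_Icc_of_wavelet_ne_zero hW hs)) h

theorem integral_mul_wavelet_eq_sum (hW : IsWaveletPair φ ψ a b r) {z : ℝ → ℝ} {y : ℤ → ℝ}
    (hz : ∀ s, D.wavelet ψ i j s ≠ 0 → z s = y ⌊s / D.ξ⌋) :
    ∫ s, z s * D.wavelet ψ i j s = ∑ m ∈ D.cells a b i j, y m * D.weight ψ i j m := by
  simp only [mul_wavelet_eq_sum hW hz]
  rw [integral_finsetSum]
  · refine Finset.sum_congr rfl fun m _ => ?_
    rw [integral_const_mul, integral_indicator measurableSet_Ico, weight]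
  · exact fun m _ => ((integrable_wavelet hW).indicator measurableSet_Ico).const_mul _

/-- If the high rate is in force on all cells that meet the support of `ψᵢⱼ`, and this support
lies in the past, then the empirical coefficient is a weighted sum of the data. -/
theorem coeff_eq_sum (hW : IsWaveletPair φ ψ a b r) {R : ℤ → SamplingRate} {y : ℤ → ℝ} {t : ℝ}
    (hR : ∀ m ∈ D.cells a b i j, R m = SamplingRate.high) (ht : (b + j) / D.level i < t) :
    D.coeff ψ R y t i j = ∑ m ∈ D.cells a b i j, y m * D.weight ψ i j m := by
  refine integral_mul_wavelet_eq_sum hW fun s hs => ?_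
  have h := mem_Icc_of_wavelet_ne_zero hW hs
  -- The closed support has to end strictly before `t`, because the imputed function is already zero
  -- at `t`.
  rw [imputed, if_pos (h.2.trans_lt ht), lastSample_of_high]
  exact hR _ (floor_mem_cells h)

/-- Replacing a continuous function by nearby values on the grid changes the wavelet coefficient
by little. -/
theorem abs_sum_weight_sub_le (hW : IsWaveletPair φ ψ a b r) {y : ℤ → ℝ} {G : ℝ → ℝ}
    (hG : Continuous G) {e : ℝ}
    (he : ∀ s ∈ Set.Icc ((a + j) / D.level i) ((b + j) / D.level i), |y ⌊s / D.ξ⌋ - G s| ≤ e) :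
    |∑ m ∈ D.cells a b i j, y m * D.weight ψ i j m - ∫ s, G s * D.wavelet ψ i j s| ≤
      e * ((√(D.level i))⁻¹ * ∫ v, |ψ v|) := by
  have hz : ∀ s, D.wavelet ψ i j s ≠ 0 → (fun s => y ⌊s / D.ξ⌋) s = y ⌊s / D.ξ⌋ := fun _ _ => rfl
  rw [← integral_mul_wavelet_eq_sum hW hz, ← integral_sub _ (integrable_mul_wavelet hW hG),
    ← integral_abs_wavelet (j := j), ← integral_const_mul, ← Real.norm_eq_abs]
  · refine norm_integral_le_of_norm_le ((integrable_wavelet hW).abs.const_mul _)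
      (Eventually.of_forall fun s => ?_)
    rw [← sub_mul, Real.norm_eq_abs, abs_mul]
    by_cases hs : D.wavelet ψ i j s = 0
    · simp [hs]
    · have := he s (mem_Icc_of_wavelet_ne_zero hW hs)
      gcongr
  · rw [funext (mul_wavelet_eq_sum hW hz)]
    exact integrable_finsetSum _ fun m _ =>
      ((integrable_wavelet hW).indicator measurableSet_Ico).const_mul _

theorem abs_weight_le {M : ℝ} (hM : ∀ v, |ψ v| ≤ M) (m : ℤ) :
    |D.weight ψ i j m| ≤ √(D.level i) * M * D.ξ := by
  have := norm_setIntegral_le_of_norm_le_const (μ := volume)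
    (s := Set.Ico (m * D.ξ) ((m + 1) * D.ξ)) (f := D.wavelet ψ i j)
    (C := √(D.level i) * M) (by simp) fun s _ => by
      rw [wavelet, Real.norm_eq_abs, abs_mul, abs_of_nonneg (Real.sqrt_nonneg _)]
      exact mul_le_mul_of_nonneg_left (hM _) (Real.sqrt_nonneg _)
  rw [Real.norm_eq_abs] at this
  refine this.trans_eq ?_
  rw [Real.volume_real_Ico_of_le (by have := D.ξ_pos; nlinarith)]
  ring

/-- At most `(b - a) / (pᵢ ξ) + 2` cells occur, each with squared weight at most `pᵢ M² ξ²`; `pᵢ ξ ≤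
1` absorbs the two boundary cells. The resulting order `ξ`, uniform in the level, is to be compared
with squared signal coefficients of order `1 / pᵢ`. -/
theorem sum_sq_weight_le {M : ℝ} (hM : ∀ v, |ψ v| ≤ M) (hab : a ≤ b)
    (hξ : D.level i * D.ξ ≤ 1) :
    ∑ m ∈ D.cells a b i j, D.weight ψ i j m ^ 2 ≤ D.ξ * (M ^ 2 * (b - a + 2)) := by
  have hp := D.level_pos i
  have hξ0 := D.ξ_pos
  have h1 : ∀ m ∈ D.cells a b i j, D.weight ψ i j m ^ 2 ≤ D.level i * M ^ 2 * D.ξ ^ 2 := by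
    intro m _
    rw [← sq_abs]
    calc _ ≤ (√(D.level i) * M * D.ξ) ^ 2 := by gcongr; exact abs_weight_le hM m
      _ = _ := by rw [mul_pow, mul_pow, Real.sq_sqrt hp.le]
  refine (Finset.sum_le_card_nsmul _ _ _ h1).trans ?_
  have hle : (a + j) / D.level i / D.ξ ≤ (b + j) / D.level i / D.ξ := by gcongr
  have hcard : ((D.cells a b i j).card : ℝ) ≤ (b - a) / D.level i / D.ξ + 2 := by
    have h2 : ((D.cells a b i j).card : ℤ) = D.cellAt i j b + 1 - D.cellAt i j a := by
      rw [cells, Int.card_Icc, Int.toNat_of_nonneg]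
      have := Int.floor_le_floor hle
      unfold cellAt; omega
    have h3 : ((D.cells a b i j).card : ℝ) = D.cellAt i j b + 1 - D.cellAt i j a := by
      exact_mod_cast h2
    rw [h3]
    have h4 := Int.floor_le ((b + j) / D.level i / D.ξ)
    have h5 := Int.lt_floor_add_one ((a + j) / D.level i / D.ξ)
    have h6 : (b - a) / D.level i / D.ξ =
      (b + j) / D.level i / D.ξ - (a + j) / D.level i / D.ξ := by ring
    unfold cellAt; linarith
  rw [nsmul_eq_mul]
  calc _ ≤ ((b - a) / D.level i / D.ξ + 2) * (D.level i * M ^ 2 * D.ξ ^ 2) := by gcongr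
    _ = D.ξ * (M ^ 2 * (b - a + 2 * (D.level i * D.ξ))) := by field_simp
    _ ≤ _ := by gcongr; linarith

end Design

/-! ### Chebyshev bounds conditional on the past. -/

theorem IsErrorLaw.memLp {law : Measure ℝ} {σ B : ℝ} (h : IsErrorLaw law σ B) (hB : 0 ≤ B) :
    MemLp (fun x : ℝ => x) 2 law := by
  have := h.isProbability
  rw [memLp_two_iff_integrable_sq (by fun_prop)]
  refine ((integrable_const (1 : ℝ)).add h.moment).mono (by fun_prop)
    (Eventually.of_forall fun x => ?_)
  have h0 : 0 ≤ |x| ^ (6 + B) := by positivity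
  rw [Real.norm_of_nonneg (sq_nonneg x), Pi.add_apply, Real.norm_of_nonneg (by linarith),
    ← sq_abs]
  rcases le_total |x| 1 with h1 | h1
  · nlinarith [abs_nonneg x]
  · have : |x| ^ (2 : ℝ) ≤ |x| ^ (6 + B) := Real.rpow_le_rpow_of_exponent_le h1 (by linarith)
    rw [Real.rpow_two] at this
    linarith

namespace IsErrorProcess

variable {Ω : Type*} [mΩ : MeasurableSpace Ω] {P : Measure Ω}
  {F : Filtration ℤ mΩ} {law : Measure ℝ} {ε : ℤ → Ω → ℝ} {σ B : ℝ}

theorem measurable (hε : IsErrorProcess P F law ε) (k : ℤ) : Measurable (ε k) :=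
  (hε.adapted k).mono (F.le k) le_rfl

theorem indepFun_past (hε : IsErrorProcess P F law ε) {k : ℤ} {X : Ω → ℝ}
    (hX : Measurable[F (k - 1)] X) : IndepFun X (ε k) P := by
  rw [IndepFun_iff_Indep]
  exact indep_of_indep_of_le_left (hε.indep_past k).symm hX.comap_le

theorem measurable_sum (hε : IsErrorProcess P F law ε) (w : ℤ → ℝ) {s : Finset ℤ} {k : ℤ}
    (hs : ∀ m ∈ s, m ≤ k) : Measurable[F k] fun ω => ∑ m ∈ s, ε m ω * w m :=
  Finset.measurable_fun_sum s fun m hm =>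
    ((hε.adapted m).mono (F.mono (hs m hm)) le_rfl).mul_const _

theorem memLp (hε : IsErrorProcess P F law ε) (hlaw : IsErrorLaw law σ B) (hB : 0 ≤ B) (k : ℤ) :
    MemLp (ε k) 2 P := by
  have h := hlaw.memLp hB
  rw [← hε.has_law k] at h
  exact (memLp_map_measure_iff (by fun_prop) (hε.measurable k).aemeasurable).1 h

theorem integral_eq_zero (hε : IsErrorProcess P F law ε) (hlaw : IsErrorLaw law σ B) (k : ℤ) :
    ∫ ω, ε k ω ∂P = 0 := by
  rw [← hlaw.mean, ← hε.has_law k, integral_map (hε.measurable k).aemeasurable (by fun_prop)]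

theorem integral_sq (hε : IsErrorProcess P F law ε) (hlaw : IsErrorLaw law σ B) (k : ℤ) :
    ∫ ω, ε k ω ^ 2 ∂P = σ ^ 2 := by
  rw [← hlaw.variance, ← hε.has_law k, integral_map (hε.measurable k).aemeasurable (by fun_prop)]

theorem memLp_sum (hε : IsErrorProcess P F law ε) (hlaw : IsErrorLaw law σ B) (hB : 0 ≤ B)
    (w : ℤ → ℝ) (s : Finset ℤ) : MemLp (fun ω => ∑ m ∈ s, ε m ω * w m) 2 P :=
  memLp_finsetSum s fun m _ => (hε.memLp hlaw hB m).mul_const (w m)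

/-- The conditional second moment, given the past, of a weighted sum of errors. -/
theorem setIntegral_sum_sq (hε : IsErrorProcess P F law ε) (hlaw : IsErrorLaw law σ B)
    (hB : 0 ≤ B) (w : ℤ → ℝ) {k : ℤ} {E : Set Ω} (hE : MeasurableSet[F (k - 1)] E)
    (s : Finset ℤ) (hs : ∀ m ∈ s, k ≤ m) :
    ∫ ω in E, (∑ m ∈ s, ε m ω * w m) ^ 2 ∂P = P.real E * (σ ^ 2 * ∑ m ∈ s, w m ^ 2) := by
  have hE' : MeasurableSet E := F.le _ _ hE
  -- The latest error is split off, so that both `E` and the remaining sum are known before it and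
  -- the cross term vanishes.
  induction s using Finset.induction_on_max with
  | empty => simp
  | insert n s hn ih =>
    have hns : n ∉ s := fun h => lt_irrefl _ (hn n h)
    have ih := ih fun m hm => hs m (Finset.mem_insert_of_mem hm)
    have hkn : k ≤ n := hs n (Finset.mem_insert_self _ _)
    set S : Ω → ℝ := fun ω => ∑ m ∈ s, ε m ω * w m with hS
    have hSm : Measurable[F (n - 1)] S := hε.measurable_sum w fun m hm => by
      have := hn m hm; omega
    have hEn : MeasurableSet[F (n - 1)] E := F.mono (by omega) _ hE
    have hSL : MemLp S 2 P := hε.memLp_sum hlaw hB w s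
    have hεL := hε.memLp hlaw hB n
    have hcross : ∫ ω in E, S ω * ε n ω ∂P = 0 := by
      rw [← integral_indicator hE']
      have h1 : ∀ ω, E.indicator (fun ω => S ω * ε n ω) ω = E.indicator S ω * ε n ω := fun ω => by
        rw [Set.indicator_mul_left]
      simp only [h1]
      have h2 := hε.indepFun_past (hSm.indicator hEn)
      rw [h2.integral_fun_mul_eq_mul_integral
        ((hSm.indicator hEn).mono (F.le _) le_rfl).aestronglyMeasurable
        (hε.measurable n).aestronglyMeasurable, hε.integral_eq_zero hlaw, mul_zero]
    have hsq : ∫ ω in E, ε n ω ^ 2 ∂P = P.real E * σ ^ 2 := by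
      rw [← integral_indicator hE']
      have h1 : ∀ ω, E.indicator (fun ω => ε n ω ^ 2) ω =
          E.indicator (fun _ => (1 : ℝ)) ω * (ε n ω) ^ 2 := fun ω => by
        by_cases h : ω ∈ E <;> simp [h]
      simp only [h1]
      have h3 : Measurable[F (n - 1)] (E.indicator fun _ => (1 : ℝ)) :=
        measurable_const.indicator hEn
      have h2 : IndepFun (E.indicator fun _ => (1 : ℝ)) (fun ω => ε n ω ^ 2) P :=
        (hε.indepFun_past h3).comp (φ := id) (ψ := fun x : ℝ => x ^ 2) measurable_id (by fun_prop)
      rw [h2.integral_fun_mul_eq_mul_integral (h3.mono (F.le _) le_rfl).aestronglyMeasurable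
        ((hε.measurable n).pow_const 2).aestronglyMeasurable, hε.integral_sq hlaw,
        integral_indicator_const _ hE', smul_eq_mul, mul_one]
    have hexp : ∀ ω, (∑ m ∈ insert n s, ε m ω * w m) ^ 2 =
        S ω ^ 2 + 2 * w n * (S ω * ε n ω) + w n ^ 2 * ε n ω ^ 2 := fun ω => by
      rw [Finset.sum_insert hns]; ring
    simp only [hexp]
    have i1 : Integrable (fun ω => S ω ^ 2) (P.restrict E) := hSL.integrable_sq.integrableOn
    have i2 : Integrable (fun ω => 2 * w n * (S ω * ε n ω)) (P.restrict E) :=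
      (hSL.integrable_mul hεL).integrableOn.const_mul _
    have i3 : Integrable (fun ω => w n ^ 2 * ε n ω ^ 2) (P.restrict E) :=
      hεL.integrable_sq.integrableOn.const_mul _
    rw [integral_add (f := fun ω => S ω ^ 2 + 2 * w n * (S ω * ε n ω)) (i1.add i2) i3,
      integral_add i1 i2, integral_const_mul, integral_const_mul, ih, hcross, hsq,
      Finset.sum_insert hns]
    ring

/-- Chebyshev's inequality, conditionally on the past. -/
theorem measureReal_inter_le (hε : IsErrorProcess P F law ε) (hlaw : IsErrorLaw law σ B)
    (hB : 0 ≤ B) (w : ℤ → ℝ) {k : ℤ} {E : Set Ω} (hE : MeasurableSet[F (k - 1)] E)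
    {s : Finset ℤ} (hs : ∀ m ∈ s, k ≤ m) {t q : ℝ} (ht : 0 < t)
    (hq : σ ^ 2 * ∑ m ∈ s, w m ^ 2 ≤ q * t ^ 2) :
    P.real (E ∩ {ω | t ≤ |∑ m ∈ s, ε m ω * w m|}) ≤ P.real E * q := by
  have hE' : MeasurableSet E := F.le _ _ hE
  have h1 := mul_meas_ge_le_integral_of_nonneg (μ := P.restrict E)
    (f := fun ω => (∑ m ∈ s, ε m ω * w m) ^ 2) (Eventually.of_forall fun _ => sq_nonneg _)
    (hε.memLp_sum hlaw hB w s).integrable_sq.integrableOn (t ^ 2)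
  rw [hε.setIntegral_sum_sq hlaw hB w hE s hs] at h1
  have h2 : {ω | t ^ 2 ≤ (∑ m ∈ s, ε m ω * w m) ^ 2} = {ω | t ≤ |∑ m ∈ s, ε m ω * w m|} := by
    ext ω
    simp only [Set.mem_ofPred_eq]
    rw [← sq_abs (∑ m ∈ s, ε m ω * w m), sq_le_sq₀ ht.le (abs_nonneg _)]
  rw [h2, measureReal_restrict_apply' hE', Set.inter_comm] at h1
  have h3 : P.real E * (σ ^ 2 * ∑ m ∈ s, w m ^ 2) ≤ P.real E * (q * t ^ 2) := by gcongr
  have h4 : 0 < t ^ 2 := by positivity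
  refine le_of_mul_le_mul_left ?_ h4
  linarith

/-- Weighted sums of errors over successive blocks of grid times are simultaneously large with a
probability that is at most geometrically small in the number of blocks. -/
theorem measureReal_inter_iInter_le (hε : IsErrorProcess P F law ε) (hlaw : IsErrorLaw law σ B)
    (hB : 0 ≤ B) (w : ℕ → ℤ → ℝ) {k : ℤ} {E : Set Ω} (hE : MeasurableSet[F (k - 1)] E)
    (lo hi : ℕ → ℤ) (hk : k ≤ lo 0) (hle : ∀ n, lo n ≤ hi n) (hlt : ∀ n, hi n < lo (n + 1))
    {t q : ℝ} (ht : 0 < t) (hq0 : 0 ≤ q)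
    (hq : ∀ n, σ ^ 2 * ∑ m ∈ Finset.Icc (lo n) (hi n), w n m ^ 2 ≤ q * t ^ 2) (N : ℕ) :
    P.real (E ∩ {ω | ∀ n < N, t ≤ |∑ m ∈ Finset.Icc (lo n) (hi n), ε m ω * w n m|}) ≤
      P.real E * q ^ N := by
  set A : ℕ → Set Ω := fun N =>
    E ∩ {ω | ∀ n < N, t ≤ |∑ m ∈ Finset.Icc (lo n) (hi n), ε m ω * w n m|} with hA
  have hsucc : ∀ N, A (N + 1) =
      A N ∩ {ω | t ≤ |∑ m ∈ Finset.Icc (lo N) (hi N), ε m ω * w N m|} := fun N => by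
    ext ω
    simp only [hA, Set.mem_inter_iff, Set.mem_ofPred_eq, Nat.forall_lt_succ_right, and_assoc]
  -- The first `N` blocks end before `lo N`, so `A N` can serve as the conditioning event for block
  -- `N`; each block then contributes a factor `q`.
  have hmeas : ∀ N, MeasurableSet[F (lo N - 1)] (A N) := by
    intro N
    induction N with
    | zero => simpa [hA] using F.mono (by omega) _ hE
    | succ N ih =>
      have h1 := hle N
      have h2 := hlt N
      rw [hsucc]
      refine (F.mono (by omega) _ ih).inter ?_
      have hm : Measurable[F (lo (N + 1) - 1)]
          fun ω => ∑ m ∈ Finset.Icc (lo N) (hi N), ε m ω * w N m :=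
        hε.measurable_sum _ fun m hm => by
          have := (Finset.mem_Icc.1 hm).2; omega
      exact (continuous_abs.measurable.comp hm) measurableSet_Ici
  change P.real (A N) ≤ _
  induction N with
  | zero => simp [hA]
  | succ N ih =>
    rw [hsucc]
    refine (hε.measureReal_inter_le hlaw hB (w N) (hmeas N)
      (fun m hm => (Finset.mem_Icc.1 hm).1) ht (hq N)).trans ?_
    rw [pow_succ, ← mul_assoc]
    gcongr

end IsErrorProcess

/-! ### Location and number of the fluctuations. -/

/-- Off the closed set `S` the fluctuation vanishes on a neighbourhood, hence so does its `r`-th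
derivative. This places the whole core `|s - u| ≤ η / f`, and in particular the centre, inside any
closed interval that contains the support. -/
theorem mem_of_iteratedDeriv_ne_zero {γ : ℝ → ℝ} {r : ℕ} {η f u s : ℝ} (hf : 0 < f)
    (hη : ∀ z, |z| ≤ η → iteratedDeriv r γ z ≠ 0) {S : Set ℝ} (hS : IsClosed S)
    (hsupp : Function.support (fluctuation γ f u) ⊆ S) (hs : |s - u| ≤ η / f) : s ∈ S := by
  by_contra hsS
  refine hη (f * (s - u)) ?_ ?_
  · rwa [abs_mul, abs_of_pos hf, mul_comm, ← le_div_iff₀ hf]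
  · have hc : ContinuousAt (fun z => u + z / f) (f * (s - u)) := by fun_prop
    have hv : u + f * (s - u) / f = s := by field_simp; ring
    have hev : ∀ᶠ z in 𝓝 (f * (s - u)), u + z / f ∈ Sᶜ :=
      hc.eventually_mem (by rw [hv]; exact hS.isOpen_compl.mem_nhds hsS)
    have hz : γ =ᶠ[𝓝 (f * (s - u))] fun _ => 0 := hev.mono fun z hz => by
      by_contra h
      refine hz (hsupp ?_)
      rw [Function.mem_support, fluctuation]
      convert h using 2
      field_simp; ring_nf
    rw [hz.iteratedDeriv_eq, iteratedDeriv_const]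
    simp

namespace IsCluster

variable {γ : ℝ → ℝ} {J : Set ℝ} {K : Set ℕ} {α u : ℕ → ℝ}

/-- On the interval around one of the fluctuations all others vanish. -/
theorem signal_eq (h : IsCluster γ J K α u) (hγ : Continuous γ)
    (hγ_supp : Function.support γ ⊆ Set.Icc (-1) 1) (g₀ : ℝ → ℝ) {k : ℕ} (hk : k ∈ K) {s : ℝ}
    (hs : s ∈ Set.Ioo (u k - (α k)⁻¹) (u k + (α k)⁻¹)) :
    signal g₀ γ K α u s = g₀ s + γ (α k * (s - u k)) := by
  rw [signal, tsum_eq_single (⟨k, hk⟩ : K)]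
  · rfl
  · rintro ⟨m, hm⟩ hmk
    by_contra hne
    -- The set where a continuous `γ` is nonzero is open, so it avoids the endpoints `±1`;
    -- disjointness of the open intervals is then enough.
    have hmem : α m * (s - u m) ∈ Set.Ioo (-1 : ℝ) 1 := by
      rw [← interior_Icc]
      refine interior_maximal hγ_supp ?_ hne
      exact hγ.isOpen_support
    have hpos := h.freq_pos m hm
    have hsm : s ∈ Set.Ioo (u m - (α m)⁻¹) (u m + (α m)⁻¹) := by
      have h1 : -(α m)⁻¹ < s - u m := by
        rw [neg_lt, ← mul_lt_mul_iff_right₀ hpos, mul_inv_cancel₀ hpos.ne']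
        linarith [hmem.1]
      have h2 : s - u m < (α m)⁻¹ := by
        rw [← mul_lt_mul_iff_right₀ hpos, mul_inv_cancel₀ hpos.ne']
        exact hmem.2
      constructor <;> linarith
    refine Set.disjoint_left.1 (h.no_overlap k hk m hm fun e => hmk ?_) hs hsm
    subst e; rfl

/-- There are at most proportionally many fluctuations of frequency at most `q` in a bounded
region. -/
theorem exists_finset_card_le (h : IsCluster γ J K α u) {q M : ℝ} (hq : 0 < q) (hM : 0 ≤ M) :
    ∃ S : Finset ℕ, (∀ k, k ∈ S ↔ k ∈ K ∧ α k ≤ q ∧ |u k| ≤ M) ∧ (S.card : ℝ) ≤ 2 * M * q + 2 := by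
  set T : Set ℕ := {k | k ∈ K ∧ α k ≤ q ∧ |u k| ≤ M} with hT
  set I : Finset ℤ := Finset.Icc ⌊-M * q⌋ ⌊M * q⌋ with hI
  have hmaps : Set.MapsTo (fun k => ⌊u k * q⌋) T I := fun k hk => by
    have := abs_le.1 hk.2.2
    rw [hI, Finset.coe_Icc]
    exact ⟨Int.floor_le_floor (by nlinarith), Int.floor_le_floor (by nlinarith)⟩
  have hinj : Set.InjOn (fun k => ⌊u k * q⌋) T := by
    intro k hk m hm hkm
    by_contra hne
    -- Centres in the same cell of length `1 / q` are closer than `1 / q`, while both half-widths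
    -- are at least `1 / q`; so `u k` lies in both intervals.
    have h1 : |u k - u m| < q⁻¹ := by
      have := Int.abs_sub_lt_one_of_floor_eq_floor hkm
      rwa [← sub_mul, abs_mul, abs_of_pos hq, ← lt_div_iff₀ hq, one_div] at this
    have hk' : q⁻¹ ≤ (α k)⁻¹ := inv_anti₀ (h.freq_pos k hk.1) hk.2.1
    have hm' : q⁻¹ ≤ (α m)⁻¹ := inv_anti₀ (h.freq_pos m hm.1) hm.2.1
    have hq' : 0 < q⁻¹ := inv_pos.2 hq
    have h2 := abs_lt.1 h1
    exact Set.disjoint_left.1 (h.no_overlap k hk.1 m hm.1 hne)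
      (show u k ∈ Set.Ioo _ _ from ⟨by linarith, by linarith⟩) ⟨by linarith, by linarith⟩
  have hfin : T.Finite := Set.Finite.of_injOn hmaps hinj I.finite_toSet
  refine ⟨hfin.toFinset, fun k => by rw [Set.Finite.mem_toFinset, hT, Set.mem_ofPred_eq], ?_⟩
  have hcard : hfin.toFinset.card ≤ I.card :=
    Finset.card_le_card_of_injOn _ (by simpa using hmaps) (by simpa using hinj)
  have hle : ⌊-M * q⌋ ≤ ⌊M * q⌋ := Int.floor_le_floor (by nlinarith)
  have h2 : (I.card : ℤ) = ⌊M * q⌋ + 1 - ⌊-M * q⌋ := by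
    rw [hI, Int.card_Icc, Int.toNat_of_nonneg]; omega
  have h3 : (I.card : ℝ) = ⌊M * q⌋ + 1 - ⌊-M * q⌋ := by exact_mod_cast h2
  have h4 := Int.floor_le (M * q)
  have h5 := Int.lt_floor_add_one (-M * q)
  have h6 : (hfin.toFinset.card : ℝ) ≤ I.card := by exact_mod_cast hcard
  linarith

end IsCluster

/-! ### Choice of the level and of the translates that detect a fluctuation. -/

namespace Design

variable (D : Design) {φ ψ g₀ γ : ℝ → ℝ} {a b : ℝ} {r : ℕ}

theorem exists_level {z : ℝ} (hz : D.p ≤ z) : ∃ i, z / 2 ≤ D.level i ∧ D.level i ≤ z := by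
  have hp := D.p_pos
  obtain ⟨i, h1, h2⟩ := exists_nat_pow_near ((one_le_div hp).2 hz) one_lt_two
  rw [le_div_iff₀ hp] at h1
  rw [div_lt_iff₀ hp, pow_succ] at h2
  exact ⟨i, by unfold level; linarith, h1⟩

/-- The spacing between the translates of `ψ` that are used to detect one fluctuation. -/
noncomputable def spacing (a b : ℝ) : ℕ := ⌈b - a⌉₊ + 2

/-- The `n`-th translation parameter, at level `i`, used to detect a fluctuation at `u`. -/
noncomputable def shift (a b : ℝ) (i : ℕ) (u : ℝ) (n : ℕ) : ℤ :=
  ⌊D.level i * u⌋ + n * spacing a b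

/-- The ratio of the wavelet level to the frequency of a fluctuation for which `N` translates of
`ψ` fit into the part of the fluctuation of relative size `η`. -/
noncomputable def fineness (a b η : ℝ) (N : ℕ) : ℝ :=
  2 * (N * spacing a b + |a| + |b| + 3) / η

theorem fineness_pos {η : ℝ} (hη : 0 < η) (N : ℕ) : 0 < fineness a b η N := by
  unfold fineness; positivity

variable {D}

theorem cellAt_le {i : ℕ} {j : ℤ} (hab : a ≤ b) : D.cellAt i j a ≤ D.cellAt i j b := by
  have := D.level_pos i
  have := D.ξ_pos
  exact Int.floor_le_floor (by gcongr)

/-- The spacing leaves a gap of at least `2 / pᵢ ≥ 2 ξ` between consecutive supports, so they share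
no grid cell and the corresponding noise sums involve disjoint blocks of errors. -/
theorem cellAt_shift_lt {i : ℕ} (hξ : D.level i * D.ξ ≤ 1) (u : ℝ) (n : ℕ) :
    D.cellAt i (D.shift a b i u n) b < D.cellAt i (D.shift a b i u (n + 1)) a := by
  have hp := D.level_pos i
  have hξ0 := D.ξ_pos
  have hL : b - a + 2 ≤ (spacing a b : ℝ) := by
    have := Nat.le_ceil (b - a)
    unfold spacing; push_cast; linarith
  rw [← Int.add_one_le_iff, cellAt, cellAt, Int.le_floor]
  have h1 := Int.floor_le ((b + D.shift a b i u n) / D.level i / D.ξ)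
  have h2 : (b + D.shift a b i u n) / D.level i / D.ξ + 1 ≤
      (a + D.shift a b i u (n + 1)) / D.level i / D.ξ := by
    rw [div_div, div_div, ← le_sub_iff_add_le', ← sub_div, le_div_iff₀ (by positivity)]
    unfold shift; push_cast; linarith
  push_cast
  linarith

/-- In units of `1 / pᵢ`, rounding `pᵢ u` costs one, the reserved grid step `ξ` costs at most one,
and the third unit in `fineness` makes the inequality strict. The factor `2` in `fineness` pays for
the level being prescribed only up to a factor two. -/
theorem abs_sub_add_lt {η f u : ℝ} {N i n : ℕ} (hη : 0 < η) (hf : 0 < f)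
    (hi : fineness a b η N * f / 2 ≤ D.level i) (hξ : D.level i * D.ξ ≤ 1) (hn : n < N)
    {v : ℝ} (hv : v ∈ Set.Icc a b) :
    |(v + D.shift a b i u n) / D.level i - u| + D.ξ < η / f := by
  have hp := D.level_pos i
  have h1 : |v| ≤ |a| + |b| := by
    rw [abs_le]
    constructor
    · linarith [hv.1, neg_abs_le a, abs_nonneg b]
    · linarith [hv.2, le_abs_self b, abs_nonneg a]
  have h2 : |(v + D.shift a b i u n) - D.level i * u| ≤ N * spacing a b + |a| + |b| + 1 := by
    have h3 := Int.floor_le (D.level i * u)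
    have h4 := Int.lt_floor_add_one (D.level i * u)
    have h5 : (n : ℝ) * spacing a b ≤ N * spacing a b := by gcongr
    have h6 : (0 : ℝ) ≤ n * spacing a b := by positivity
    have h7 := abs_le.1 h1
    unfold shift; push_cast
    rw [abs_le]
    constructor <;> linarith
  have h3 : (v + D.shift a b i u n) / D.level i - u =
      ((v + D.shift a b i u n) - D.level i * u) / D.level i := by field_simp
  have h4 : D.ξ ≤ 1 / D.level i := by rw [le_div_iff₀ hp]; linarith
  rw [h3, abs_div, abs_of_pos hp]
  have h5 : |(v + D.shift a b i u n) - D.level i * u| / D.level i ≤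
    (N * spacing a b + |a| + |b| + 1) / D.level i := by gcongr
  have h6 : (N * spacing a b + |a| + |b| + 2) / D.level i < η / f := by
    rw [div_lt_div_iff₀ hp hf]
    have h7 : η * (fineness a b η N * f / 2) ≤ η * D.level i := by gcongr
    have h8 : η * (fineness a b η N * f / 2) = (N * spacing a b + |a| + |b| + 3) * f := by
      unfold fineness; field_simp
    nlinarith
  have h9 : (N * spacing a b + |a| + |b| + 2) / D.level i =
    (N * spacing a b + |a| + |b| + 1) / D.level i + 1 / D.level i := by ring
  linarith

end Design

/-! ### Pathwise consequences of a reduction of the rate. -/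

namespace Design

variable {D : Design} {φ ψ g₀ γ : ℝ → ℝ} {a b : ℝ} {r : ℕ}

/-- If a fluctuation is supported in the window that is inspected by the downward rule, and the
rule is satisfied, then the noise must mask the fluctuation at each of the chosen wavelets. -/
theorem le_abs_noise (hW : IsWaveletPair φ ψ a b r) (hγ : Continuous γ) {η κ : ℝ} (hη0 : 0 < η)
    (hη1 : η < 1) (hηγ : ∀ z, |z| ≤ η → iteratedDeriv r γ z ≠ 0)
    (hκ : 0 < κ)
    (hκγ : ∀ lam > 0, ∀ ζ, (∀ v ∈ Set.Icc a b, |ζ + v / lam| ≤ η) →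
      κ / lam ^ r ≤ |∫ v, γ (ζ + v / lam) * ψ v|)
    {f u e δ : ℝ} {N i : ℕ} {k : ℤ} (hf : 0 < f)
    (hi1 : fineness a b η N * f / 2 ≤ D.level i) (hi2 : D.level i ≤ fineness a b η N * f)
    (hξ : D.level i * D.ξ ≤ 1) (hπ : D.π₂ ≤ D.level i) (hq : D.level i ≤ D.level D.q₂)
    (hδ : δ * √(D.level i) ≤ κ / fineness a b η N ^ r / 4)
    (heA : 2 * e * ∫ v, |ψ v| ≤ κ / fineness a b η N ^ r / 4)
    (hg₀ : ∀ s, |s - u| ≤ f⁻¹ → |g₀ s - g₀ u| ≤ e)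
    (hγe : ∀ s s', |s - s'| ≤ f * D.ξ → |γ s - γ s'| ≤ e)
    {sig : ℝ → ℝ} (hsig : ∀ s ∈ Set.Ioo (u - f⁻¹) (u + f⁻¹), sig s = g₀ s + γ (f * (s - u)))
    (hsupp : Function.support (fluctuation γ f u) ⊆
      Set.Icc ((k - D.delaySteps a b : ℤ) * D.ξ) (k * D.ξ))
    {R : ℤ → SamplingRate} {ε y : ℤ → ℝ} (hy : ∀ m : ℤ, y m = sig (m * D.ξ) + ε m)
    (hR : ∀ m, k - D.delaySteps a b ≤ m → m < k → R m = SamplingRate.high)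
    (hdown : D.DownCondition a b ψ δ R y (k * D.ξ)) {n : ℕ} (hn : n < N) :
    k - D.delaySteps a b ≤ D.cellAt i (D.shift a b i u n) a ∧
    κ / fineness a b η N ^ r / 2 / √(D.level i) ≤
      |∑ m ∈ D.cells a b i (D.shift a b i u n), ε m * D.weight ψ i (D.shift a b i u n) m| := by
  set j := D.shift a b i u n with hj
  set Λ := fineness a b η N with hΛ
  set κ' := κ / Λ ^ r with hκ'
  have hp := D.level_pos i
  have hξ0 := D.ξ_pos
  have hab : a ≤ b := (hW.a_neg.trans hW.b_pos).le
  have hnear : ∀ v ∈ Set.Icc a b, |(v + j) / D.level i - u| + D.ξ < η / f := fun v hv =>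
    abs_sub_add_lt hη0 hf hi1 hξ hn hv
  have hwin : ∀ s, |s - u| ≤ η / f →
      s ∈ Set.Icc ((k - D.delaySteps a b : ℤ) * D.ξ) (k * D.ξ) := fun s hs =>
    mem_of_iteratedDeriv_ne_zero hf hηγ isClosed_Icc hsupp hs
  have hwin' : ∀ v ∈ Set.Icc a b, (k - D.delaySteps a b : ℤ) * D.ξ ≤ (v + j) / D.level i ∧
      (v + j) / D.level i < k * D.ξ := by
    intro v hv
    have h1 := hnear v hv
    refine ⟨(hwin _ (by linarith)).1, ?_⟩
    -- The reserved grid step makes the support end strictly before `k ξ`, so only cells before the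
    -- current time are involved.
    have h2 := (hwin ((v + j) / D.level i + D.ξ) (by
      have := abs_add_le ((v + j) / D.level i - u) D.ξ
      rw [abs_of_pos hξ0] at this
      rw [add_sub_right_comm]
      linarith)).2
    linarith
  have ha := hwin' a ⟨le_rfl, hab⟩
  have hb := hwin' b ⟨hab, le_rfl⟩
  have hlo : k - D.delaySteps a b ≤ D.cellAt i j a := by
    rw [cellAt, Int.le_floor, le_div_iff₀ hξ0]
    exact ha.1
  have hhi : D.cellAt i j b < k := by
    rw [cellAt, Int.floor_lt, div_lt_iff₀ hξ0]
    exact hb.2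
  refine ⟨hlo, ?_⟩
  have hRc : ∀ m ∈ D.cells a b i j, R m = SamplingRate.high := fun m hm => by
    have := Finset.mem_Icc.1 hm
    exact hR m (hlo.trans this.1) (this.2.trans_lt hhi)
  have hψ : ∃ v, ψ v ≠ 0 := by
    by_contra! h
    exact hW.moment_ne_zero (by simp [h])
  obtain ⟨v₀, hv₀⟩ := hψ
  have hcoeff := hdown i j hπ hq ⟨(v₀ + j) / D.level i, by
      have h1 := hwin' v₀ (hW.support_ψ hv₀)
      have h2 : (k : ℝ) * D.ξ - D.delay a b = (k - D.delaySteps a b : ℤ) * D.ξ := by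
        rw [delay]; push_cast; ring
      rw [h2]
      exact ⟨h1.1, h1.2.le⟩, by
      rw [wavelet, mul_div_cancel₀ _ hp.ne', add_sub_cancel_right]
      exact mul_ne_zero (Real.sqrt_pos.2 hp).ne' hv₀⟩
  rw [coeff_eq_sum hW hRc hb.2] at hcoeff
  simp only [hy, add_mul, Finset.sum_add_distrib] at hcoeff
  -- Freezing `g₀` at `u` costs `e`, sampling `γ` on the grid another `e`; the constant `g₀ u` is
  -- invisible because `∫ ψ = 0`.
  set G : ℝ → ℝ := fun s => g₀ u + γ (f * (s - u)) with hG
  have hGc : Continuous G := by fun_prop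
  have happrox := abs_sum_weight_sub_le (D := D) (i := i) (j := j) hW
    (y := fun m => sig (m * D.ξ)) hGc (e := 2 * e) (by
      intro s hs
      have hfl := floor_div_eq_iff (D := D).1 (rfl : ⌊s / D.ξ⌋ = _)
      set s' := (⌊s / D.ξ⌋ : ℝ) * D.ξ with hs'
      have hss' : |s' - s| ≤ D.ξ := by
        rw [abs_le]; constructor <;> nlinarith [hfl.1, hfl.2]
      have hsu : |s - u| + D.ξ < η / f := by
        have hv : D.level i * s - j ∈ Set.Icc a b := by
          have h1 := (div_le_iff₀ hp).1 hs.1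
          have h2 := (le_div_iff₀ hp).1 hs.2
          constructor <;> linarith
        have := hnear _ hv
        rwa [sub_add_cancel, mul_div_cancel_left₀ _ hp.ne'] at this
      have hηf : η / f < f⁻¹ := by
        rw [div_eq_mul_inv]
        exact mul_lt_of_lt_one_left (inv_pos.2 hf) hη1
      have hs'u : |s' - u| < f⁻¹ := by
        have := abs_add_le (s' - s) (s - u)
        rw [sub_add_sub_cancel] at this
        linarith
      have h1 := hg₀ s' hs'u.le
      have h2 := hγe (f * (s' - u)) (f * (s - u)) (by
        rw [← mul_sub, sub_sub_sub_cancel_right, abs_mul, abs_of_pos hf]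
        gcongr)
      have h3 := abs_lt.1 hs'u
      rw [hsig s' ⟨by linarith, by linarith⟩, hG]
      have h4 : g₀ s' + γ (f * (s' - u)) - (g₀ u + γ (f * (s - u))) =
        (g₀ s' - g₀ u) + (γ (f * (s' - u)) - γ (f * (s - u))) := by ring
      change |g₀ s' + γ (f * (s' - u)) - (g₀ u + γ (f * (s - u)))| ≤ _
      rw [h4]
      exact (abs_add_le _ _).trans (by linarith))
  rw [integral_mul_wavelet] at happrox
  set lam := D.level i / f with hlam
  have hlam0 : 0 < lam := by positivity
  have harg : ∀ v, f * ((v + j) / D.level i - u) = f * (j / D.level i - u) + v / lam := fun v => by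
    rw [hlam]; field_simp; ring
  have hint : ∫ v, G ((v + j) / D.level i) * ψ v =
      ∫ v, γ (f * (j / D.level i - u) + v / lam) * ψ v := by
    simp only [hG, add_mul, harg]
    rw [integral_add (hW.integrable_ψ.const_mul _) (hW.integrable_mul (by fun_prop)),
      integral_const_mul, hW.integral_ψ, mul_zero, zero_add]
  have hlow := hκγ lam hlam0 (f * (j / D.level i - u)) (fun v hv => by
    rw [← harg, abs_mul, abs_of_pos hf, mul_comm, ← le_div_iff₀ hf]
    linarith [hnear v hv])
  rw [← hint] at hlow
  have hΛ0 : 0 < Λ := fineness_pos hη0 N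
  have hlamΛ : lam ≤ Λ := by rw [hlam, div_le_iff₀ hf]; exact hi2
  have hκlow : κ' ≤ κ / lam ^ r := by rw [hκ']; gcongr
  have hsq : 0 < √(D.level i) := Real.sqrt_pos.2 hp
  set I := ∫ v, G ((v + j) / D.level i) * ψ v with hI
  set X := ∑ m ∈ D.cells a b i j, sig (m * D.ξ) * D.weight ψ i j m with hX
  set Z := ∑ m ∈ D.cells a b i j, ε m * D.weight ψ i j m with hZ
  have h1 : |(√(D.level i))⁻¹ * I| = (√(D.level i))⁻¹ * |I| := by
    rw [abs_mul, abs_of_pos (inv_pos.2 hsq)]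
  have h2 : |(√(D.level i))⁻¹ * I| ≤ |X| + |X - (√(D.level i))⁻¹ * I| := by
    have := abs_sub X (X - (√(D.level i))⁻¹ * I)
    rwa [sub_sub_cancel] at this
  have h3 : |X| ≤ |X + Z| + |Z| := by
    have := abs_sub (X + Z) Z
    rwa [add_sub_cancel_right] at this
  have h4 : (√(D.level i))⁻¹ * κ' ≤ (√(D.level i))⁻¹ * |I| := by
    gcongr; linarith
  have h5 : 2 * e * ((√(D.level i))⁻¹ * ∫ v, |ψ v|) ≤ (√(D.level i))⁻¹ * (κ' / 4) := by
    calc _ = (√(D.level i))⁻¹ * (2 * e * ∫ v, |ψ v|) := by ring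
      _ ≤ _ := by gcongr
  have h6 : δ ≤ (√(D.level i))⁻¹ * (κ' / 4) := by
    rw [inv_mul_eq_div, le_div_iff₀ hsq]; exact hδ
  -- Of the signal's `κ'`, a quarter is lost to discretisation and a quarter to the threshold; the
  -- noise must supply the remaining half.
  have h7 : κ' / 2 / √(D.level i) = (√(D.level i))⁻¹ * κ' - (√(D.level i))⁻¹ * (κ' / 4) -
      (√(D.level i))⁻¹ * (κ' / 4) := by ring
  rw [h7]
  linarith

/-- After a start at the high rate at the beginning of an interval, the first reduction of the
rate within the interval happens with a full window inside the interval. -/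
theorem exists_drop {x y : ℝ} {δ : ℝ} {R : ℤ → SamplingRate} {Y : ℤ → ℝ}
    (hstart : D.StartsHigh x R) (hstay : ¬ D.StaysHigh (Set.Icc x y) R)
    (hrule : D.FollowsDownRule a b ψ δ R Y) :
    ∃ k : ℤ, ⌈x / D.ξ⌉ ≤ k - D.delaySteps a b ∧ k * D.ξ ≤ y ∧
      (∀ m, k - D.delaySteps a b ≤ m → m < k → R m = SamplingRate.high) ∧
      D.DownCondition a b ψ δ R Y (k * D.ξ) := by
  have hξ := D.ξ_pos
  set k₀ := ⌈x / D.ξ⌉ with hk₀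
  simp only [StaysHigh, not_forall] at hstay
  obtain ⟨k₁, hk₁, hR₁⟩ := hstay
  have hk₀₁ : k₀ ≤ k₁ := Int.ceil_le.2 ((div_le_iff₀ hξ).2 hk₁.1)
  obtain ⟨k, ⟨hk, hRk⟩, hmin⟩ := Int.exists_least_of_bdd
    (P := fun k => k₀ ≤ k ∧ R k ≠ SamplingRate.high) ⟨k₀, fun z hz => hz.1⟩ ⟨k₁, hk₀₁, hR₁⟩
  have hne : k ≠ k₀ := fun h => hRk (h ▸ hstart.1)
  have hprev : R (k - 1) = SamplingRate.high := by
    by_contra h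
    have := hmin (k - 1) ⟨by omega, h⟩
    omega
  have hlow : R k = SamplingRate.low := by
    cases h : R k with
    | low => rfl
    | high => exact absurd h hRk
  obtain ⟨h1, h2⟩ := (hrule k hprev).1 hlow
  refine ⟨k, ?_, ?_, h1, h2⟩
  -- A window reaching back before `k₀` would contain `k₀ - 1`, where the rate is low.
  · by_contra! h
    have h3 := h1 (k₀ - 1) (by omega) (by omega)
    rw [hstart.2] at h3
    cases h3
  · have h3 : (k : ℝ) ≤ k₁ := by exact_mod_cast hmin k₁ ⟨hk₀₁, hR₁⟩
    exact le_trans (by gcongr) hk₁.2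

end Design

/-! ### Probability bound for a fixed design. -/

namespace Design

variable {D : Design} {φ ψ g₀ γ : ℝ → ℝ} {a b : ℝ} {r : ℕ}

theorem measurableSet_startsHigh {Ω : Type*} [mΩ : MeasurableSpace Ω] {F : Filtration ℤ mΩ}
    {R : ℤ → Ω → SamplingRate}
    (hR : ∀ k, MeasurableSet[F (k - 1)] {ω | R k ω = SamplingRate.high}) (x : ℝ) :
    MeasurableSet[F (⌈x / D.ξ⌉ - 1)] {ω | D.StartsHigh x fun k => R k ω} := by
  have h : {ω | D.StartsHigh x fun k => R k ω} =
      {ω | R ⌈x / D.ξ⌉ ω = SamplingRate.high} ∩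
        {ω | R (⌈x / D.ξ⌉ - 1) ω = SamplingRate.high}ᶜ := by
    ext ω
    simp only [StartsHigh, Set.mem_ofPred_eq, Set.mem_inter_iff, Set.mem_compl_iff]
    cases R (⌈x / D.ξ⌉ - 1) ω <;> simp
  rw [h]
  exact (hR _).inter (F.mono (by omega) _ (hR _)).compl

theorem measurableSet_staysHigh {Ω : Type*} [mΩ : MeasurableSpace Ω] {F : Filtration ℤ mΩ}
    {R : ℤ → Ω → SamplingRate}
    (hR : ∀ k, MeasurableSet[F (k - 1)] {ω | R k ω = SamplingRate.high}) (J : Set ℝ) :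
    MeasurableSet {ω | D.StaysHigh J fun k => R k ω} := by
  have h : {ω | D.StaysHigh J fun k => R k ω} =
      ⋂ (k : ℤ) (_ : (k : ℝ) * D.ξ ∈ J), {ω | R k ω = SamplingRate.high} := by
    ext ω; simp [StaysHigh]
  rw [h]
  exact MeasurableSet.iInter fun k => MeasurableSet.iInter fun _ => F.le _ _ (hR k)

/-- A bound, for a fixed design, on the probability that the high rate is given up within `J`
after it was started at the start of `J`. -/
theorem measureReal_start_inter_le (hW : IsWaveletPair φ ψ a b r) (hγ : Continuous γ)
    (hγ_supp : Function.support γ ⊆ Set.Icc (-1) 1)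
    {η κ : ℝ} (hη0 : 0 < η)
    (hη1 : η < 1) (hηγ : ∀ z, |z| ≤ η → iteratedDeriv r γ z ≠ 0)
    (hκ : 0 < κ)
    (hκγ : ∀ lam > 0, ∀ ζ, (∀ v ∈ Set.Icc a b, |ζ + v / lam| ≤ η) →
      κ / lam ^ r ≤ |∫ v, γ (ζ + v / lam) * ψ v|)
    {Mψ : ℝ} (hMψ : ∀ v, |ψ v| ≤ Mψ)
    {σ B : ℝ} {law : Measure ℝ} (hlaw : IsErrorLaw law σ B) (hB : 0 ≤ B)
    {e δ M x y : ℝ} {N : ℕ} (hN : 0 < N) (hM : 0 ≤ M) (hδ0 : 0 ≤ δ)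
    (hJ : Set.Icc x y ⊆ Set.Icc (-M) M)
    {K : Set ℕ} {α u : ℕ → ℝ} (hcluster : IsCluster γ (Set.Icc x y) K α u)
    {A : Set ℝ} (hA_window : ∀ s, x ≤ s → s + D.delay a b ≤ y → ∃ k ∈ K, α k ∈ A ∧
        Function.support (fluctuation γ (α k) (u k)) ⊆ Set.Icc s (s + D.delay a b))
    (hξ : D.level D.q₂ * D.ξ ≤ 1)
    (hδ : δ * √(D.level D.q₂) ≤ κ / fineness a b η N ^ r / 4)
    (heA : 2 * e * ∫ v, |ψ v| ≤ κ / fineness a b η N ^ r / 4)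
    (hp : ∀ f ∈ A, D.p ≤ fineness a b η N * f)
    (hπ : ∀ f ∈ A, D.π₂ ≤ fineness a b η N * f / 2)
    (hq : ∀ f ∈ A, fineness a b η N * f ≤ D.level D.q₂) (hq' : ∀ f ∈ A, f ≤ D.level D.q₂)
    (hg₀ : ∀ f ∈ A, ∀ s u, |u| ≤ M → |s - u| ≤ f⁻¹ → |g₀ s - g₀ u| ≤ e)
    (hγe : ∀ f ∈ A, ∀ s s', |s - s'| ≤ f * D.ξ → |γ s - γ s'| ≤ e)
    {Ω : Type*} [mΩ : MeasurableSpace Ω] {P : Measure Ω} [IsProbabilityMeasure P]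
    {F : Filtration ℤ mΩ} {ε Y : ℤ → Ω → ℝ} (hε : IsErrorProcess P F law ε)
    (hY : ∀ k ω, Y k ω = signal g₀ γ K α u (k * D.ξ) + ε k ω)
    {R : ℤ → Ω → SamplingRate}
    (hR_past : ∀ k, MeasurableSet[F (k - 1)] {ω | R k ω = SamplingRate.high})
    (hR_down : ∀ᵐ ω ∂P, D.FollowsDownRule a b ψ δ (fun k => R k ω) fun k => Y k ω) :
    P.real ({ω | D.StartsHigh x fun k => R k ω} ∩
        {ω | D.StaysHigh (Set.Icc x y) fun k => R k ω}ᶜ) ≤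
      (2 * M * D.level D.q₂ + 2) * (P.real {ω | D.StartsHigh x fun k => R k ω} *
        (σ ^ 2 * (Mψ ^ 2 * (b - a + 2)) * 4 / (κ / fineness a b η N ^ r) ^ 2 *
          (D.level D.q₂ * D.ξ)) ^ N) := by
  set Λ := fineness a b η N with hΛ
  set κ' := κ / Λ ^ r with hκ'
  have hΛ0 : 0 < Λ := fineness_pos hη0 N
  have hκ'0 : 0 < κ' := by positivity
  have hξ0 := D.ξ_pos
  have hab : a ≤ b := (hW.a_neg.trans hW.b_pos).le
  set Q := σ ^ 2 * (Mψ ^ 2 * (b - a + 2)) * 4 / κ' ^ 2 * (D.level D.q₂ * D.ξ) with hQ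
  have hpq := D.level_pos D.q₂
  have hQ0 : 0 ≤ Q := by
    have : 0 ≤ b - a + 2 := by linarith
    positivity
  set E := {ω | D.StartsHigh x fun k => R k ω} with hE
  have hEm := measurableSet_startsHigh (D := D) hR_past x
  have hi : ∀ k, ∃ i, α k ∈ A → Λ * α k / 2 ≤ D.level i ∧ D.level i ≤ Λ * α k := fun k => by
    by_cases hk : α k ∈ A
    · obtain ⟨i, hi⟩ := D.exists_level (hp _ hk)
      exact ⟨i, fun _ => hi⟩
    · exact ⟨0, fun h => absurd h hk⟩
  choose i hi using hi
  obtain ⟨S, hS, hcard⟩ := hcluster.exists_finset_card_le hpq hM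
  classical
  -- Only fluctuations whose first block begins at or after the start time are kept, so that `E`
  -- belongs to the past of all the errors used.
  set S' := S.filter fun k => α k ∈ A ∧ ⌈x / D.ξ⌉ ≤ D.cellAt (i k) (D.shift a b (i k) (u k) 0) a
    with hS'
  set V : ℕ → Set Ω := fun k => E ∩ {ω | ∀ n < N, κ' / 2 / √(D.level (i k)) ≤
    |∑ m ∈ D.cells a b (i k) (D.shift a b (i k) (u k) n),
      ε m ω * D.weight ψ (i k) (D.shift a b (i k) (u k) n) m|} with hV
  have hlevel : ∀ k, α k ∈ A → D.level (i k) ≤ D.level D.q₂ := fun k hk =>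
    (hi k hk).2.trans (hq _ hk)
  have hVle : ∀ k ∈ S', P.real (V k) ≤ P.real E * Q ^ N := by
    intro k hk
    obtain ⟨-, hkA, hk0⟩ := Finset.mem_filter.1 hk
    have hlp := D.level_pos (i k)
    have hl := hlevel k hkA
    have hlξ : D.level (i k) * D.ξ ≤ 1 := le_trans (by gcongr) hξ
    refine hε.measureReal_inter_iInter_le hlaw hB
      (fun n => D.weight ψ (i k) (D.shift a b (i k) (u k) n)) hEm
      (fun n => D.cellAt (i k) (D.shift a b (i k) (u k) n) a)
      (fun n => D.cellAt (i k) (D.shift a b (i k) (u k) n) b) hk0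
      (fun n => cellAt_le hab) (fun n => cellAt_shift_lt hlξ _ n)
      (by positivity) hQ0 (fun n => ?_) N
    have h1 := sum_sq_weight_le (D := D) (i := i k) (j := D.shift a b (i k) (u k) n) hMψ hab hlξ
    calc _ ≤ σ ^ 2 * (D.ξ * (Mψ ^ 2 * (b - a + 2))) := by gcongr; exact h1
      _ = Q * (κ' ^ 2 / 4 / D.level D.q₂) := by rw [hQ]; field_simp
      -- Passing from `p_{q₂}` to the lower level enlarges the squared noise bound, so one `Q`
      -- serves all fluctuations.
      _ ≤ Q * (κ' ^ 2 / 4 / D.level (i k)) := by gcongr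
      _ = _ := by rw [div_pow (κ' / 2), Real.sq_sqrt hlp.le]; ring
  have hsub : P.real (E ∩ {ω | D.StaysHigh (Set.Icc x y) fun k => R k ω}ᶜ) ≤
      P.real (⋃ k ∈ S', V k) := by
    refine ENNReal.toReal_mono (measure_ne_top _ _) (measure_mono_ae ?_)
    filter_upwards [hR_down] with ω hω hωE
    have hstart : D.StartsHigh x fun k => R k ω := hωE.1
    have hstay : ¬ D.StaysHigh (Set.Icc x y) fun k => R k ω := hωE.2
    obtain ⟨m, hm1, hm2, hm3, hm4⟩ := exists_drop hstart hstay hω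
    have hx : x ≤ (m - D.delaySteps a b : ℤ) * D.ξ := by
      rw [← div_le_iff₀ hξ0]; exact Int.ceil_le.1 hm1
    have hsm : ((m - D.delaySteps a b : ℤ) : ℝ) * D.ξ + D.delay a b = m * D.ξ := by
      rw [delay]; push_cast; ring
    obtain ⟨k, hkK, hkA, hksupp⟩ := hA_window ((m - D.delaySteps a b : ℤ) * D.ξ) hx
      (by rw [hsm]; exact hm2)
    rw [hsm] at hksupp
    have hf := hcluster.freq_pos k hkK
    have huJ : u k ∈ Set.Icc x y := mem_of_iteratedDeriv_ne_zero hf hηγ isClosed_Icc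
      (hcluster.support_subset k hkK) (by rw [sub_self, abs_zero]; positivity)
    have huM : |u k| ≤ M := abs_le.2 (hJ huJ)
    have hl := hlevel k hkA
    have hlξ : D.level (i k) * D.ξ ≤ 1 := le_trans (by gcongr) hξ
    have hδ' : δ * √(D.level (i k)) ≤ κ' / 4 := le_trans (by gcongr) hδ
    have key := fun n (hn : n < N) => le_abs_noise (D := D) hW hγ hη0 hη1 hηγ hκ hκγ hf
      (hi k hkA).1 (hi k hkA).2 hlξ ((hπ _ hkA).trans (hi k hkA).1) hl hδ' heA
      (fun s => hg₀ _ hkA s _ huM) (hγe _ hkA)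
      (fun s hs => hcluster.signal_eq hγ hγ_supp g₀ hkK hs) hksupp (fun m => hY m ω) hm3 hm4 hn
    refine Set.mem_biUnion (x := k) ?_ ⟨hωE.1, fun n hn => (key n hn).2⟩
    exact Finset.mem_coe.2 (Finset.mem_filter.2 ⟨(hS k).2 ⟨hkK, hq' _ hkA, huM⟩, hkA,
      hm1.trans (key 0 hN).1⟩)
  refine hsub.trans ((measureReal_biUnion_finset_le _ _).trans
    ((Finset.sum_le_card_nsmul _ _ _ hVle).trans ?_))
  rw [nsmul_eq_mul]
  have h1 : (S'.card : ℝ) ≤ S.card := by exact_mod_cast Finset.card_filter_le _ _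
  have h2 : 0 ≤ P.real E * Q ^ N := by positivity
  gcongr
  linarith

end Design

/-! ### Asymptotics of the tuning parameters. -/

namespace Design

theorem ρ₁_le_ρ₂ (D : Design) : D.ρ₁ ≤ D.ρ₂ := by
  have hξ := D.ξ_pos
  have hℓ : (1 : ℝ) ≤ D.ℓ := by exact_mod_cast D.ℓ_pos
  exact inv_anti₀ hξ (le_mul_of_one_le_left hξ.le hℓ)

variable {D : ℝ → Design}

theorem eventually_level_le {c : ℝ}
    (hpq : (fun ν => (2 : ℝ) ^ (D ν).q₂) =O[atTop] fun ν => (D ν).p⁻¹ * (D ν).ρ₂ ^ (1 - c)) :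
    ∃ C₀ > 0, ∀ᶠ ν in atTop, (D ν).level (D ν).q₂ ≤ C₀ * (D ν).ρ₂ ^ (1 - c) := by
  obtain ⟨C₀, hC₀, h⟩ := hpq.exists_pos
  refine ⟨C₀, hC₀, h.bound.mono fun ν hν => ?_⟩
  have hp := (D ν).p_pos
  have hρ : 0 < (D ν).ρ₂ := inv_pos.2 (D ν).ξ_pos
  rw [Real.norm_of_nonneg (by positivity), Real.norm_of_nonneg (by positivity)] at hν
  calc (D ν).level (D ν).q₂ = 2 ^ (D ν).q₂ * (D ν).p := rfl
    _ ≤ C₀ * ((D ν).p⁻¹ * (D ν).ρ₂ ^ (1 - c)) * (D ν).p := by gcongr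
    _ = _ := by field_simp

theorem eventually_level_mul_ξ_le {c : ℝ} {C₀ : ℝ}
    (h : ∀ᶠ ν in atTop, (D ν).level (D ν).q₂ ≤ C₀ * (D ν).ρ₂ ^ (1 - c)) :
    ∀ᶠ ν in atTop, (D ν).level (D ν).q₂ * (D ν).ξ ≤ C₀ * (D ν).ρ₂ ^ (-c) := by
  filter_upwards [h] with ν hν
  have hξ := (D ν).ξ_pos
  have hρ : 0 < (D ν).ρ₂ := inv_pos.2 hξ
  have h1 : (D ν).ξ = (D ν).ρ₂ ^ (-1 : ℝ) := by rw [Real.rpow_neg_one, ρ₂, inv_inv]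
  calc _ ≤ C₀ * (D ν).ρ₂ ^ (1 - c) * (D ν).ξ := by gcongr
    _ = C₀ * ((D ν).ρ₂ ^ (1 - c) * (D ν).ρ₂ ^ (-1 : ℝ)) := by rw [← h1]; ring
    _ = _ := by rw [← Real.rpow_add hρ]; ring_nf

theorem tendsto_level_mul_ξ {c C₀ : ℝ} (hc : 0 < c)
    (hρ : Tendsto (fun ν => (D ν).ρ₂) atTop atTop)
    (h : ∀ᶠ ν in atTop, (D ν).level (D ν).q₂ * (D ν).ξ ≤ C₀ * (D ν).ρ₂ ^ (-c)) :
    Tendsto (fun ν => (D ν).level (D ν).q₂ * (D ν).ξ) atTop (𝓝 0) := by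
  have h1 := ((tendsto_rpow_neg_atTop hc).comp hρ).const_mul C₀
  rw [mul_zero] at h1
  exact tendsto_of_tendsto_of_tendsto_of_le_of_le' tendsto_const_nhds h1
    (Eventually.of_forall fun ν => by
      have := (D ν).level_pos (D ν).q₂
      have := (D ν).ξ_pos
      positivity) h

/-- The threshold is of smaller order than the wavelet coefficients of the fluctuations. -/
theorem tendsto_threshold_mul {c C₀ : ℝ} (hc : 0 < c) (C σ : ℝ)
    (hρ : Tendsto (fun ν => (D ν).ρ₂) atTop atTop)
    (h : ∀ᶠ ν in atTop, (D ν).level (D ν).q₂ * (D ν).ξ ≤ C₀ * (D ν).ρ₂ ^ (-c)) :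
    Tendsto (fun ν => (D ν).threshold C σ * √((D ν).level (D ν).q₂)) atTop (𝓝 0) := by
  -- Up to the factor `(C σ)²` this is the square of the quantity in question; the logarithm loses
  -- against `ρ₂ ^ (-c)`.
  have h1 : Tendsto (fun ν => Real.log (D ν).ρ₂ * ((D ν).level (D ν).q₂ * (D ν).ξ))
      atTop (𝓝 0) := by
    have h2 := ((isLittleO_log_rpow_atTop hc).tendsto_div_nhds_zero.comp hρ).const_mul C₀
    rw [mul_zero] at h2
    refine tendsto_of_tendsto_of_tendsto_of_le_of_le' tendsto_const_nhds h2 ?_ ?_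
    · filter_upwards [hρ.eventually_ge_atTop 1] with ν hν
      have := (D ν).level_pos (D ν).q₂
      have := (D ν).ξ_pos
      have := Real.log_nonneg hν
      positivity
    · filter_upwards [hρ.eventually_ge_atTop 1, h] with ν hν hν'
      have := Real.log_nonneg hν
      calc _ ≤ Real.log (D ν).ρ₂ * (C₀ * (D ν).ρ₂ ^ (-c)) := by gcongr
        _ = _ := by
          rw [Real.rpow_neg (by linarith), Function.comp_apply]; ring
  have h3 := (h1.sqrt).const_mul (C * σ)
  rw [Real.sqrt_zero, mul_zero] at h3
  refine h3.congr fun ν => ?_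
  rw [threshold, mul_assoc (C * σ) (√_), ← Real.sqrt_mul' _ ((D ν).level_pos _).le]
  congr 2
  rw [ρ₂, inv_inv]; ring

/-- The exponent `1 / (2r + 1)` is at most one, so `p = O(ρ₁) = o(π₂)`. Hence levels comparable to
frequencies in `A` are not below the primary level. -/
theorem eventually_p_le {r : ℕ} (hρ₁ : Tendsto (fun ν => (D ν).ρ₁) atTop atTop)
    (hp : (fun ν => (D ν).p) =Θ[atTop] fun ν => (D ν).ρ₁ ^ ((1 : ℝ) / (2 * r + 1)))
    (hπ : (fun ν => (D ν).ρ₁) =o[atTop] fun ν => (D ν).π₂) :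
    ∀ᶠ ν in atTop, (D ν).p ≤ (D ν).π₂ := by
  have h1 : (fun ν => (D ν).ρ₁ ^ ((1 : ℝ) / (2 * r + 1))) =O[atTop] fun ν => (D ν).ρ₁ := by
    refine IsBigO.of_bound 1 ?_
    filter_upwards [hρ₁.eventually_ge_atTop 1] with ν hν
    rw [Real.norm_of_nonneg (by positivity), Real.norm_of_nonneg (by positivity), one_mul]
    refine (Real.rpow_le_rpow_of_exponent_le hν ?_).trans_eq (Real.rpow_one _)
    rw [div_le_one (by positivity)]
    have : (0 : ℝ) ≤ r := by positivity
    linarith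
  filter_upwards [((hp.isBigO.trans h1).trans_isLittleO hπ).bound one_pos] with ν hν
  rwa [Real.norm_of_nonneg (D ν).p_pos.le, Real.norm_of_nonneg (D ν).π₂_pos.le, one_mul] at hν

theorem tendsto_π₂ (hρ₁ : Tendsto (fun ν => (D ν).ρ₁) atTop atTop)
    (hπ : (fun ν => (D ν).ρ₁) =o[atTop] fun ν => (D ν).π₂) :
    Tendsto (fun ν => (D ν).π₂) atTop atTop := by
  refine tendsto_atTop_mono' _ ?_ hρ₁
  filter_upwards [hπ.bound one_pos] with ν hν
  rw [Real.norm_of_nonneg (D ν).π₂_pos.le, one_mul] at hν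
  exact (le_abs_self _).trans hν

end Design

/-- The bound on the number of fluctuations times the `N`-th power of the Chebyshev bound vanishes
in the limit, if `N` is large enough. -/
theorem tendsto_card_bound_mul_pow {D : ℝ → Design} {c C₀ M q : ℝ} {N : ℕ} (hc : 0 < c)
    (hN : 1 < c * N) (hC₀ : 0 < C₀) (hM : 0 ≤ M) (hq : 0 ≤ q)
    (hρ : Tendsto (fun ν => (D ν).ρ₂) atTop atTop)
    (h1 : ∀ᶠ ν in atTop, (D ν).level (D ν).q₂ ≤ C₀ * (D ν).ρ₂ ^ (1 - c))
    (h2 : ∀ᶠ ν in atTop, (D ν).level (D ν).q₂ * (D ν).ξ ≤ C₀ * (D ν).ρ₂ ^ (-c)) :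
    Tendsto (fun ν => (2 * M * (D ν).level (D ν).q₂ + 2) *
      (q * ((D ν).level (D ν).q₂ * (D ν).ξ)) ^ N) atTop (𝓝 0) := by
  have h3 := ((tendsto_rpow_neg_atTop (sub_pos.2 hN)).comp hρ).const_mul
    ((2 * M * C₀ + 2) * (q * C₀) ^ N)
  rw [mul_zero] at h3
  have h0 : ∀ ν, 0 ≤ (D ν).level (D ν).q₂ ∧ 0 ≤ (D ν).ξ := fun ν =>
    ⟨((D ν).level_pos _).le, (D ν).ξ_pos.le⟩
  refine tendsto_of_tendsto_of_tendsto_of_le_of_le' tendsto_const_nhds h3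
    (Eventually.of_forall fun ν => ?_) ?_
  · obtain ⟨hl, hξ⟩ := h0 ν
    positivity
  · filter_upwards [h1, h2, hρ.eventually_ge_atTop 1] with ν hν1 hν2 hν
    obtain ⟨hl, hξ⟩ := h0 ν
    have hρ0 : 0 < (D ν).ρ₂ := by linarith
    -- Giving away the factor `ρ₂ ^ (-c)` is harmless, since `N` is chosen with `c N > 1`.
    have hle : (D ν).level (D ν).q₂ ≤ C₀ * (D ν).ρ₂ := hν1.trans (by
      gcongr
      exact (Real.rpow_le_rpow_of_exponent_le hν (by linarith)).trans_eq (Real.rpow_one _))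
    have hA : 2 * M * (D ν).level (D ν).q₂ + 2 ≤ (2 * M * C₀ + 2) * (D ν).ρ₂ := by
      have : 2 * M * (D ν).level (D ν).q₂ ≤ 2 * M * (C₀ * (D ν).ρ₂) := by gcongr
      linarith
    calc _ ≤ (2 * M * C₀ + 2) * (D ν).ρ₂ * (q * (C₀ * (D ν).ρ₂ ^ (-c))) ^ N := by gcongr
      _ = (2 * M * C₀ + 2) * (q * C₀) ^ N * ((D ν).ρ₂ ^ (1 : ℝ) * ((D ν).ρ₂ ^ (-c)) ^ N) := by
        rw [Real.rpow_one, ← mul_assoc q, mul_pow]; ring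
      _ = _ := by
        rw [← Real.rpow_natCast ((D ν).ρ₂ ^ (-c)), ← Real.rpow_mul hρ0.le,
          ← Real.rpow_add hρ0, Function.comp_apply]
        congr 2; ring

/-! ### Passage to the limit. -/

theorem theorem4p5
    -- wavelets, smooth part of the signal, shape of the fluctuations
    (φ ψ : ℝ → ℝ) (a b : ℝ) (r : ℕ) (hW : IsWaveletPair φ ψ a b r)
    (g₀ γ : ℝ → ℝ) (hg₀ : ContDiff ℝ r g₀) (hγ : ContDiff ℝ r γ)
    (hγ_supp : Function.support γ ⊆ Set.Icc (-1) 1) (hγ_zero : iteratedDeriv r γ 0 ≠ 0)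
    -- constants and error distribution
    (c C σ B : ℝ) (hc : c ∈ Set.Ioo (0 : ℝ) 1) (hC : √2 < C) (hσ : 0 < σ)
    (hB : C ^ 2 / (1 - c) < B) (law : Measure ℝ) (hlaw : IsErrorLaw law σ B)
    -- tuning parameters, as functions of the index `ν`
    (D : ℝ → Design) (hρ₁ : Tendsto (fun ν => (D ν).ρ₁) atTop atTop)
    (hp : (fun ν => (D ν).p) =Θ[atTop] fun ν => (D ν).ρ₁ ^ ((1 : ℝ) / (2 * r + 1)))
    (hq : Tendsto (fun ν => (D ν).q₂) atTop atTop)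
    (hpq : (fun ν => (2 : ℝ) ^ (D ν).q₂) =O[atTop] fun ν => (D ν).p⁻¹ * (D ν).ρ₂ ^ (1 - c))
    (hπ : (fun ν => (D ν).ρ₁) =o[atTop] fun ν => (D ν).π₂)
    (hπq : ∀ᶠ ν in atTop, (D ν).π₂ ≤ (D ν).level (D ν).q₂)
    -- the interval `J = [x, y]`, which stays in a bounded region, and the fluctuations in it
    (x y : ℝ → ℝ) (hxy : ∀ ν, x ν ≤ y ν)
    (hJ : ∃ M, ∀ᶠ ν in atTop, Set.Icc (x ν) (y ν) ⊆ Set.Icc (-M) M)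
    (K : ℝ → Set ℕ) (α u : ℝ → ℕ → ℝ)
    (hcluster : ∀ ν, IsCluster γ (Set.Icc (x ν) (y ν)) (K ν) (α ν) (u ν))
    -- every subinterval of `J` of length `τ₀` contains a fluctuation with frequency in `A`
    (A : ℝ → Set ℝ) (hA : ∀ ν, A ν ⊆ α ν '' K ν)
    (hA_window : ∀ ν s, x ν ≤ s → s + (D ν).delay a b ≤ y ν →
      ∃ k ∈ K ν, α ν k ∈ A ν ∧
        Function.support (fluctuation γ (α ν k) (u ν k)) ⊆ Set.Icc s (s + (D ν).delay a b))
    (hA_min : ∀ η > 0, ∀ᶠ ν in atTop, ∀ f ∈ A ν, (D ν).π₂ ≤ η * f)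
    (hA_max : ∀ η > 0, ∀ᶠ ν in atTop, ∀ f ∈ A ν, f ≤ η * (D ν).level (D ν).q₂)
    -- the errors and the data `g(k ξ) + ε k`
    (Ω : ℝ → Type*) [mΩ : ∀ ν, MeasurableSpace (Ω ν)] (P : ∀ ν, Measure (Ω ν))
    [∀ ν, IsProbabilityMeasure (P ν)] (F : ∀ ν, Filtration ℤ (mΩ ν))
    (ε : ∀ ν, ℤ → Ω ν → ℝ) (hε : ∀ ν, IsErrorProcess (P ν) (F ν) law (ε ν))
    (Y : ∀ ν, ℤ → Ω ν → ℝ)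
    (hY : ∀ ν k ω, Y ν k ω = signal g₀ γ (K ν) (α ν) (u ν) (k * (D ν).ξ) + ε ν k ω)
    -- the sampling rate: determined by the past, reduced according to the downward rule
    (R : ∀ ν, ℤ → Ω ν → SamplingRate)
    (hR_past : ∀ ν k, MeasurableSet[F ν (k - 1)] {ω | R ν k ω = SamplingRate.high})
    (hR_down : ∀ ν, ∀ᵐ ω ∂P ν, (D ν).FollowsDownRule a b ψ ((D ν).threshold C σ)
      (fun k => R ν k ω) (fun k => Y ν k ω))
    -- with positive probability, sampling at the high rate starts at the start of `J`
    (hR_start : ∀ ν, P ν {ω | (D ν).StartsHigh (x ν) (fun k => R ν k ω)} ≠ 0) :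
    -- conditionally on that, the rate is high throughout `J` with probability tending to one
    Tendsto (fun ν => ProbabilityTheory.cond (P ν)
        {ω | (D ν).StartsHigh (x ν) (fun k => R ν k ω)}
        {ω | (D ν).StaysHigh (Set.Icc (x ν) (y ν)) (fun k => R ν k ω)}) atTop (𝓝 1) := by
  obtain ⟨η, hη0, hη1, hηγ, κ, hκ, hκγ⟩ := hW.exists_le_abs_integral hγ hγ_zero
  obtain ⟨Mψ, hMψ⟩ := hW.bounded_ψ
  have hc0 := hc.1
  have hC0 : 0 < C := (Real.sqrt_pos.2 two_pos).trans hC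
  have hB0 : 0 ≤ B := le_trans (div_nonneg (sq_nonneg C) (by linarith [hc.2])) hB.le
  obtain ⟨M₀, hM₀⟩ := hJ
  set M := max M₀ 0 with hM
  have hM0 : 0 ≤ M := le_max_right _ _
  obtain ⟨N, hN⟩ := exists_nat_gt c⁻¹
  have hcN : 1 < c * N := by rwa [inv_lt_iff_one_lt_mul₀' hc0] at hN
  have hN0 : 0 < N := by
    rcases Nat.eq_zero_or_pos N with h | h
    · rw [h, Nat.cast_zero, mul_zero] at hcN; linarith
    · exact h
  set Λ := Design.fineness a b η N with hΛ
  have hΛ0 : 0 < Λ := Design.fineness_pos hη0 N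
  set κ' := κ / Λ ^ r with hκ'
  have hκ'0 : 0 < κ' := by positivity
  have hI0 : 0 ≤ ∫ v, |ψ v| := integral_nonneg fun _ => abs_nonneg _
  -- Chosen so that the total discretisation error `2 e ∫ |ψ|` is at most `κ' / 4`; the `+ 1` keeps
  -- the denominator positive.
  set e := κ' / 8 / ((∫ v, |ψ v|) + 1) with he
  have he0 : 0 < e := by positivity
  have heA : 2 * e * ∫ v, |ψ v| ≤ κ' / 4 := by
    calc _ ≤ 2 * e * ((∫ v, |ψ v|) + 1) := by gcongr; linarith
      _ = _ := by rw [he]; field_simp; norm_num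
  -- moduli of continuity
  have hγu : UniformContinuous γ := by
    refine hγ.continuous.uniformContinuous_of_tendsto_cocompact (x := 0) ?_
    exact (HasCompactSupport.intro isCompact_Icc fun v hv => by
      by_contra h; exact hv (hγ_supp h)).is_zero_at_infty
  obtain ⟨d₁, hd₁, hγd⟩ := Metric.uniformContinuous_iff.1 hγu e he0
  -- One unit of margin suffices, since eventually `f⁻¹ ≤ 1` for all `f ∈ A`.
  have hg₀u : UniformContinuousOn g₀ (Set.Icc (-M - 1) (M + 1)) :=
    isCompact_Icc.uniformContinuousOn_of_continuous hg₀.continuous.continuousOn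
  obtain ⟨d₂, hd₂, hg₀d⟩ := Metric.uniformContinuousOn_iff.1 hg₀u e he0
  -- asymptotics of the parameters
  have hρ : Tendsto (fun ν => (D ν).ρ₂) atTop atTop :=
    tendsto_atTop_mono (fun ν => (D ν).ρ₁_le_ρ₂) hρ₁
  obtain ⟨C₀, hC₀, hlev⟩ := Design.eventually_level_le hpq
  have hlevξ := Design.eventually_level_mul_ξ_le hlev
  have hlevξ0 := Design.tendsto_level_mul_ξ hc0 hρ hlevξ
  have hthr := Design.tendsto_threshold_mul hc0 C σ hρ hlevξ
  set q := σ ^ 2 * (Mψ ^ 2 * (b - a + 2)) * 4 / κ' ^ 2 with hqdef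
  have hq0 : 0 ≤ q := by
    have : 0 ≤ b - a + 2 := by linarith [hW.a_neg, hW.b_pos]
    positivity
  have hbound : ∀ᶠ ν in atTop,
      (P ν).real ({ω | (D ν).StartsHigh (x ν) fun k => R ν k ω} ∩
        {ω | (D ν).StaysHigh (Set.Icc (x ν) (y ν)) fun k => R ν k ω}ᶜ) ≤
      (2 * M * (D ν).level (D ν).q₂ + 2) *
        ((P ν).real {ω | (D ν).StartsHigh (x ν) fun k => R ν k ω} *
          (q * ((D ν).level (D ν).q₂ * (D ν).ξ)) ^ N) := by
    -- `hA_min` with `Λ` makes a level near `Λ f` available, with `Λ / 2` puts it above `π₂`, and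
    -- with `1` makes all frequencies in `A` large.
    filter_upwards [hM₀, hlevξ0.eventually_le_const (lt_min one_pos (half_pos hd₁)), hthr.eventually_le_const (by positivity : 0 < κ' / 4),
      Design.eventually_p_le hρ₁ hp hπ, hA_min Λ hΛ0, hA_min (Λ / 2) (by positivity),
      hA_min 1 one_pos, hA_max Λ⁻¹ (by positivity), hA_max 1 one_pos,
      (Design.tendsto_π₂ hρ₁ hπ).eventually_ge_atTop (max 1 (2 / d₂))]
      with ν h1 h2 h3 h4 h5 h6 h7 h8 h9 h10
    have hge : ∀ f ∈ A ν, max 1 (2 / d₂) ≤ f := fun f hf => by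
      have := h7 f hf; linarith
    have hξ0 := (D ν).ξ_pos
    refine Design.measureReal_start_inter_le hW hγ.continuous hγ_supp hη0 hη1 hηγ hκ hκγ hMψ
      hlaw hB0 (e := e) hN0 hM0 ?_
      (h1.trans (Set.Icc_subset_Icc (neg_le_neg (le_max_left _ _)) (le_max_left _ _)))
      (hcluster ν) (hA_window ν) (h2.trans (min_le_left _ _)) h3 heA
      (fun f hf => h4.trans (h5 f hf)) (fun f hf => (h6 f hf).trans_eq (by ring))
      (fun f hf => ?_) (fun f hf => (h9 f hf).trans_eq (one_mul _)) (fun f hf s u hu hsu => ?_)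
      (fun f hf s s' hss' => ?_) (hε ν) (hY ν) (hR_past ν) (hR_down ν)
    · exact mul_nonneg (by positivity) (Real.sqrt_nonneg _)
    · have := h8 f hf
      rwa [inv_mul_eq_div, le_div_iff₀ hΛ0, mul_comm] at this
    · have hf1 := hge f hf
      have hf2 : f⁻¹ ≤ 1 := inv_le_one_of_one_le₀ ((le_max_left _ _).trans hf1)
      have hf3 : f⁻¹ ≤ d₂ / 2 := by
        rw [← inv_div]
        exact inv_anti₀ (by positivity) ((le_max_right _ _).trans hf1)
      have hu' := abs_le.1 hu
      have hsu' := abs_le.1 hsu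
      have := hg₀d s ⟨by linarith, by linarith⟩ u ⟨by linarith, by linarith⟩
        (by rw [Real.dist_eq]; linarith)
      rw [Real.dist_eq] at this
      exact this.le
    · have hf1 : f * (D ν).ξ ≤ d₁ / 2 := by
        calc f * (D ν).ξ ≤ (D ν).level (D ν).q₂ * (D ν).ξ := by
              gcongr; exact (h9 f hf).trans_eq (one_mul _)
          _ ≤ _ := h2.trans (min_le_right _ _)
      have := hγd (a := s) (b := s') (by rw [Real.dist_eq]; linarith)
      rw [Real.dist_eq] at this
      exact this.le
  -- passage to conditional probabilities
  have hlim := tendsto_card_bound_mul_pow hc0 hcN hC₀ hM0 hq0 hρ hlev hlevξ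
  have hreal : Tendsto (fun ν => (ProbabilityTheory.cond (P ν)
      {ω | (D ν).StartsHigh (x ν) fun k => R ν k ω}).real
        {ω | (D ν).StaysHigh (Set.Icc (x ν) (y ν)) fun k => R ν k ω}ᶜ) atTop (𝓝 0) := by
    refine tendsto_of_tendsto_of_tendsto_of_le_of_le' tendsto_const_nhds hlim
      (Eventually.of_forall fun ν => measureReal_nonneg) (hbound.mono fun ν hν => ?_)
    -- The factor `P(start)` in the bound cancels, so the start event may itself become arbitrarily
    -- rare.
    have hpos : 0 < (P ν).real {ω | (D ν).StartsHigh (x ν) fun k => R ν k ω} :=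
      ENNReal.toReal_pos (hR_start ν) (measure_ne_top _ _)
    rw [measureReal_def, cond_apply
        ((F ν).le _ _ (Design.measurableSet_startsHigh (hR_past ν) (x ν))),
      ENNReal.toReal_mul, ENNReal.toReal_inv, ← measureReal_def, ← measureReal_def,
      inv_mul_le_iff₀ hpos]
    refine hν.trans_eq (by ring)
  have hprob : ∀ ν, IsProbabilityMeasure (ProbabilityTheory.cond (P ν)
      {ω | (D ν).StartsHigh (x ν) fun k => R ν k ω}) := fun ν =>
    cond_isProbabilityMeasure (hR_start ν)
  have hfin := ENNReal.tendsto_ofReal (hreal.const_sub 1)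
  rw [sub_zero, ENNReal.ofReal_one] at hfin
  refine hfin.congr fun ν => ?_
  rw [probReal_compl_eq_one_sub (Design.measurableSet_staysHigh (hR_past ν) _), sub_sub_cancel,
    ofReal_measureReal]
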